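/- **Setting.** A bipedal robot on flat ground has configuration space $\mathbb R^{N_C}$. A foot placement is a point of $\mathbb R^2\times(\mathbb R/2\pi\mathbb Z)$ (position and yaw). A mode $\sigma$ is either a single support (a foot and its placement) or a double support (a placement of each foot). Each mode has a set $F_\sigma\subset\mathbb R^{N_C}$ of feasible configurations. Each $F_\sigma$, and each set $F_\sigma\cap F_\tau$ of transitions between a double-support mode $\tau$ and the single-support mode $\sigma$ of one of its feet, is a manifold with a finite atlas whose charts have nonempty ranges of finite volume. Two such modes $\sigma,\tau$ are adjacent if $F_\sigma\cap F_\tau\ne\emptyset$; a left and a right placement are mutually reachable if their double-support mode is adjacent to both single-support modes. The exploration space $\mathscr E$ is a box in $\mathbb R^6$ (translation and Euler angles, with the Euclidean metric and volume of $\mathbb R^6$). A map $\mathrm{Proj}$ sends states (configuration, mode) to $\mathbb R^6$; $C_N\subset\mathscr E$ is measurable and contains the projections of all feasible states. A start state $(q_{\rm start},\sigma_{\rm start})$ and a goal state $(q_{\rm goal},\sigma_{\rm goal})$ in single support are given, with projections $p_{\rm start},p_{\rm goal}$. **The w-RPG.** (1) *Possibility Exploration*: draw $N_P$ independent uniform samples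 of $C_N$; connect any two of these points and $p_{\rm start},p_{\rm goal}$ whose straight segment lies in $C_N$. Every route (walk) from $p_{\rm start}$ to $p_{\rm goal}$ found is passed on; routes visiting the same samples are identified, and the runs of the later stages for different routes are independent given the pose samples. (2) *Mode Sampling*: for a route, let $\mathcal F_\sigma\subset\mathbb R^2$ be the union of the discs of radius $\rho>0$ around the $xy$-projections of its vertices; draw $N_\sigma$ left and $N_\sigma$ right placements independently and uniformly from $\mathcal F_\sigma\times(\mathbb R/2\pi\mathbb Z)$. Together with the start and goal placements they give the single-support modes of all viable placements (those with $F_\sigma\neq\emptyset$) and the double-support modes of all mutually reachable pairs. (3) *Multi-modal PRM*: draw $N_M$ configurations from each sampled mode and $N_M$ transitions from each pair of adjacent sampled modes (independently: a uniform chart, then a uniform point in its range). Within a mode, connect two vertices (samples, transitions, start, goal) if in some chart the straight segment between them stays in the chart's range; each transition joins its two modes. Success means that the roadmap contains a path from the start to the goal. **Hypotheses.** (a) There are $M\ge 0$ intermediate single-support modes with alternating feet and cylinders $\varsigma_1,\dots,\varsigma_M$ of placements (disc of radius $r_i>0$ times yaw arc of length $0<\Delta\theta_i\le2\pi$) such that,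 with $\varsigma_0,\varsigma_{M+1}$ consisting of the start and the goal placement only, every placement in $\varsigma_{i+1}$ is reachable from every placement in $\varsigma_i$ ($0\le i\le M$). Here reachable means the following: there are configurations $s_i(x)$ for standing at $x\in\varsigma_i$, equal to $q_{\rm start}$ and $q_{\rm goal}$ for $i=0$ and $i=M+1$, such that for $x\in\varsigma_i$, $y\in\varsigma_{i+1}$ a continuous feasible motion leads from $s_i(x)$ to $s_{i+1}(y)$ through single support at $x$, double support at $(x,y)$ and single support at $y$. (b) $\gamma_P:[0,L]\to\mathbb R^6$ is a path parametrized by arclength from $p_{\rm start}$ to $p_{\rm goal}$, with $R=\inf_s \mathrm{dist}(\gamma_P(s),\mathbb R^6\setminus C_N)>0$. (c) $\rho\ge 2h_m$, where $h_m=\sup_{\sigma\in\bigcup_i\varsigma_i}\inf_{s} d_{xy}(\sigma,\gamma_P(s))$ and $d_{xy}$ is the horizontal distance. (d) The failure probability of stage (3) is a measurable function of the placement samples. Put $\varepsilon=\min(R/2,\rho/4)$. **Theorem.** 1. Suppose $M\geq 1$. Let $r_m,\Delta\theta_m$ be the radius and height of a cylinder of least volume, and let $A$ be an upper bound for $|\mathcal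 F_\sigma|$ over all routes through $C_N$ from $p_{\rm start}$ to $p_{\rm goal}$ with $\lceil L/\varepsilon\rceil-1$ intermediate vertices ($0$ if $L=0$). Then for all $N_P,N_\sigma$ the probability that for no route found the sampled modes admit a feasible whole-body motion from the start to the goal state (i.e. that the first two stages fail) is at most $$\Big(\frac L\varepsilon+M\Big)e^{-\beta},\qquad \beta=\min\Big(\frac{\pi^3\varepsilon^6}{6|C_N|}N_P,\ \frac{r_m^2\,\Delta\theta_m}{2A}N_\sigma\Big).$$ 2. The whole pipeline is probabilistically complete: there are constants $\alpha',\beta'>0$ such that for all $N_P,N_\sigma,N_M$ the probability that the three stages find no solution is at most $\alpha'\exp(-\beta'\min(N_P,N_\sigma,N_M))$. In particular it tends to $0$ as $N_P,N_\sigma,N_M\to\infty$ jointly. -/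

import Mathlib

noncomputable section

namespace WRPG

open MeasureTheory

/-! ### Poses, foot placements, modes -/

/-- Coordinates on `SE(3)`: entries `0, 1, 2` are the translation `(x, y, z)`, entries `3, 4, 5` are
Euler angles. Lengths, balls, straight lines and volumes are those of these coordinates. -/
abbrev Pose : Type := EuclideanSpace ℝ (Fin 6)

/-- The walking plane. -/
abbrev Plane : Type := EuclideanSpace ℝ (Fin 2)

instance factTwoPiPos : Fact (0 < 2 * Real.pi) := ⟨Real.two_pi_pos⟩

/-- A foot placement on flat ground: a position in the plane and a yaw angle. -/
abbrev Placement : Type := Plane × AddCircle (2 * Real.pi)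

/-- Projection of a pose to its `(x, y)` coordinates. -/
def xy (p : Pose) : Plane := !₂[p 0, p 1]

/-- The two feet. -/
inductive Foot : Type
  | left
  | right

/-- A mode: a single support foot with its placement, or the placements of the left and of the
right foot. -/
inductive Mode : Type
  | single (f : Foot) (x : Placement)
  | double (xl xr : Placement)

/-- The placement of the foot `f` in the double-support stance `(xl, xr)`. -/
def Foot.pick : Foot → Placement → Placement → Placement
  | .left, xl, _ => xl
  | .right, _, xr => xr

/-! ### Feasible spaces as manifolds, with uniform sampling and straight-line local planning -/

/-- A finite atlas for a subset `F` of a configuration space: `F`, with its subspace topology, is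
covered by finitely many charts with values in Euclidean spaces. The range of each chart is
nonempty and has finite volume. -/
structure FiniteAtlas {n : ℕ} (F : Set (EuclideanSpace ℝ (Fin n))) where
  numCharts : ℕ
  dim : Fin numCharts → ℕ
  chart : ∀ k, OpenPartialHomeomorph F (EuclideanSpace ℝ (Fin (dim k)))
  covers : ∀ q : F, ∃ k, q ∈ (chart k).source
  target_nonempty : ∀ k, (chart k).target.Nonempty
  target_finite : ∀ k, volume (chart k).target < ⊤

namespace FiniteAtlas

variable {n : ℕ} {F : Set (EuclideanSpace ℝ (Fin n))}

/-- The law of a configuration obtained by drawing uniformly from the range of the chart `k`. -/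
def chartLaw (A : FiniteAtlas F) (k : Fin A.numCharts) : Measure (EuclideanSpace ℝ (Fin n)) :=
  (ProbabilityTheory.cond volume (A.chart k).target).map
    (fun u => (((A.chart k).symm u : F) : EuclideanSpace ℝ (Fin n)))

/-- The law of a random configuration in `F`: choose a chart uniformly, then a point uniformly in
its coordinates. If `F` is empty, sampling returns a fixed configuration (which lies outside
`F`). -/
def law (A : FiniteAtlas F) : Measure (EuclideanSpace ℝ (Fin n)) :=
  if A.numCharts = 0 then Measure.dirac 0
  else ((A.numCharts : ENNReal)⁻¹) • ∑ k, A.chartLaw k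

instance isProbabilityMeasure_chartLaw (A : FiniteAtlas F) (k : Fin A.numCharts) :
    IsProbabilityMeasure (A.chartLaw k) := by
  have hpos : volume (A.chart k).target ≠ 0 :=
    ((A.chart k).open_target.measure_pos volume (A.target_nonempty k)).ne'
  have : IsProbabilityMeasure (ProbabilityTheory.cond volume (A.chart k).target) :=
    ProbabilityTheory.cond_isProbabilityMeasure_of_finite hpos (A.target_finite k).ne
  refine Measure.isProbabilityMeasure_map ?_
  have hc : ContinuousOn (fun u => (((A.chart k).symm u : F) : EuclideanSpace ℝ (Fin n)))
      (A.chart k).target :=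
    continuous_subtype_val.comp_continuousOn (A.chart k).continuousOn_symm
  exact (hc.aemeasurable (A.chart k).open_target.measurableSet).smul_measure _

instance isProbabilityMeasure_law (A : FiniteAtlas F) : IsProbabilityMeasure A.law := by
  unfold law
  split_ifs with h
  · infer_instance
  · refine ⟨?_⟩
    simp only [Measure.smul_apply, Measure.coe_finsetSum, Finset.sum_apply, measure_univ,
      Finset.sum_const, Finset.card_univ, Fintype.card_fin, smul_eq_mul, nsmul_eq_mul, mul_one]
    exact ENNReal.inv_mul_cancel (by exact_mod_cast h) (ENNReal.natCast_ne_top _)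

/-- The local planner: two points of `F` are connected if, in the coordinates of some chart, the
straight segment between them stays in the range of the chart. -/
def Link (A : FiniteAtlas F) (q q' : EuclideanSpace ℝ (Fin n)) : Prop :=
  ∃ (k : Fin A.numCharts) (hq : q ∈ F) (hq' : q' ∈ F),
    (⟨q, hq⟩ : F) ∈ (A.chart k).source ∧ (⟨q', hq'⟩ : F) ∈ (A.chart k).source ∧
      segment ℝ (A.chart k ⟨q, hq⟩) (A.chart k ⟨q', hq'⟩) ⊆ (A.chart k).target

end FiniteAtlas

/-! ### Problem instances -/

/-- A locomotion problem of a bipedal robot on flat ground with arbitrary obstacles. -/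
structure Problem where
  /-- The dimension of the configuration space. -/
  nC : ℕ
  /-- The feasible configurations of each mode. -/
  feasible : Mode → Set (EuclideanSpace ℝ (Fin nC))
  /-- The feasible space of each mode is a manifold. -/
  modeAtlas : ∀ σ, FiniteAtlas (feasible σ)
  /-- The space of transitions between a double-support mode and the single-support mode of one
  of its feet is a manifold. -/
  transAtlas : ∀ (f : Foot) (xl xr : Placement),
    FiniteAtlas (feasible (.single f (f.pick xl xr)) ∩ feasible (.double xl xr))
  /-- Projection of states to the exploration space. -/
  proj : EuclideanSpace ℝ (Fin nC) × Mode → Pose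
  /-- The exploration space is the box of poses whose coordinates lie between `lo` and `hi`. -/
  lo : Pose
  hi : Pose
  /-- The necessary condition manifold. -/
  CN : Set Pose
  measurableSet_CN : MeasurableSet CN
  CN_subset : ∀ p ∈ CN, ∀ i, lo i ≤ p i ∧ p i ≤ hi i
  /-- The conditions defining `CN` are necessary for feasibility. -/
  necessary : ∀ σ, ∀ q ∈ feasible σ, proj (q, σ) ∈ CN
  qStart : EuclideanSpace ℝ (Fin nC)
  footStart : Foot
  xStart : Placement
  qGoal : EuclideanSpace ℝ (Fin nC)
  footGoal : Foot
  xGoal : Placement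

namespace Problem

variable (P : Problem)

abbrev Config : Type := EuclideanSpace ℝ (Fin P.nC)

/-- A state: a configuration and a mode. -/
abbrev State : Type := P.Config × Mode

def start : P.State := (P.qStart, .single P.footStart P.xStart)

def goal : P.State := (P.qGoal, .single P.footGoal P.xGoal)

def pStart : Pose := P.proj P.start

def pGoal : Pose := P.proj P.goal

/-- `|C_N|`. -/
def volCN : ℝ := (volume P.CN).toReal

/-- A left and a right foot placement can reach each other: the double-support mode is adjacent
to both single-support modes, i.e. the feasible spaces intersect. -/
def Reachable (xl xr : Placement) : Prop :=
  (P.feasible (.single .left xl) ∩ P.feasible (.double xl xr)).Nonempty ∧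
    (P.feasible (.single .right xr) ∩ P.feasible (.double xl xr)).Nonempty

/-- Change of mode without change of configuration, between a double-support mode and the
single-support mode of one of its feet. -/
inductive Switch (q : P.Config) : Mode → Mode → Prop
  | lift (f : Foot) (xl xr : Placement)
      (hs : q ∈ P.feasible (.single f (f.pick xl xr))) (hd : q ∈ P.feasible (.double xl xr)) :
      Switch q (.double xl xr) (.single f (f.pick xl xr))
  | land (f : Foot) (xl xr : Placement)
      (hs : q ∈ P.feasible (.single f (f.pick xl xr))) (hd : q ∈ P.feasible (.double xl xr)) :
      Switch q (.single f (f.pick xl xr)) (.double xl xr)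

/-- A piece of whole-body motion that uses modes from `S` only: a continuous feasible motion within
one mode, or a change of mode. -/
inductive Move (S : Set Mode) : P.State → P.State → Prop
  | within (σ : Mode) (q q' : P.Config) (hσ : σ ∈ S) (h : JoinedIn (P.feasible σ) q q') :
      Move S (q, σ) (q', σ)
  | switch (q : P.Config) (σ τ : Mode) (hσ : σ ∈ S) (hτ : τ ∈ S) (h : P.Switch q σ τ) :
      Move S (q, σ) (q, τ)

/-- There is a feasible whole-body motion from `s` to `s'` through the modes in `S`. -/
def Connects (S : Set Mode) (s s' : P.State) : Prop :=
  Relation.ReflTransGen (P.Move S) s s'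

/-! ### Stage 1: possibility exploration -/

/-- The law of `N` independent uniform samples of `C_N`. -/
def poseLaw (N : ℕ) : Measure (Fin N → Pose) :=
  Measure.pi fun _ => ProbabilityTheory.cond volume P.CN

/-- A route through `C_N`: the straight lines between consecutive poses of the list
`p_start, l, p_goal` lie in `C_N`. -/
def IsRoute (l : List Pose) : Prop :=
  List.IsChain (fun a b => segment ℝ a b ⊆ P.CN) (P.pStart :: (l ++ [P.pGoal]))

open Classical in
/-- The routes found in the graph on `p_start`, `p_goal` and the samples `p`, obtained by trying to
connect every pair of points with a straight line in `C_N`. A route is recorded through the set of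
samples which it visits. -/
def routes {N : ℕ} (p : Fin N → Pose) : Finset (Finset (Fin N)) :=
  Finset.univ.filter fun T => ∃ l : List (Fin N), l.toFinset = T ∧ P.IsRoute (l.map p)

/-! ### Stage 2: mode sampling -/

/-- The planar region `F_σ` of a route whose intermediate vertices form the set `V`: the union of
the discs of radius `ρ` around the projections of the vertices of the route. -/
def sampleRegion (ρ : ℝ) (V : Set Pose) : Set Plane :=
  ⋃ v ∈ insert P.pStart (insert P.pGoal V), Metric.closedBall (xy v) ρ

/-- The law of `N` left and `N` right foot placements, all independent, with position uniform in
`F_σ` and yaw uniform on the circle. -/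
def placementLaw (ρ : ℝ) (V : Set Pose) (N : ℕ) :
    Measure ((Fin N → Placement) × (Fin N → Placement)) :=
  (Measure.pi fun _ => ProbabilityTheory.cond volume (P.sampleRegion ρ V ×ˢ Set.univ)).prod
    (Measure.pi fun _ => ProbabilityTheory.cond volume (P.sampleRegion ρ V ×ˢ Set.univ))

/-- The placements available for the foot `f`: the samples, and the given start and goal
placements. -/
def available {N : ℕ} (s : (Fin N → Placement) × (Fin N → Placement)) (f : Foot) :
    Set Placement :=
  {x | (∃ i, x = f.pick (s.1 i) (s.2 i)) ∨ (f = P.footStart ∧ x = P.xStart) ∨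
    (f = P.footGoal ∧ x = P.xGoal)}

/-- The sampled modes: a single-support mode for each viable placement, and a double-support mode
for each pair of a left and a right placement that can reach each other. -/
inductive IsSampledMode {N : ℕ} (s : (Fin N → Placement) × (Fin N → Placement)) : Mode → Prop
  | single (f : Foot) (x : Placement) (hx : x ∈ P.available s f)
      (hv : (P.feasible (.single f x)).Nonempty) : IsSampledMode s (.single f x)
  | double (xl xr : Placement) (hl : xl ∈ P.available s .left) (hr : xr ∈ P.available s .right)
      (h : P.Reachable xl xr) : IsSampledMode s (.double xl xr)

def sampledModes {N : ℕ} (s : (Fin N → Placement) × (Fin N → Placement)) : Set Mode :=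
  {σ | P.IsSampledMode s σ}

/-! ### Stage 3: multi-modal PRM -/

/-- What the roadmap planner samples from: the feasible space of a mode, or the transitions between
the double-support mode `(xl, xr)` and the single-support mode of the foot `f`. -/
inductive Source : Type
  | mode (σ : Mode)
  | trans (f : Foot) (xl xr : Placement)

def sourceLaw : Source → Measure P.Config
  | .mode σ => (P.modeAtlas σ).law
  | .trans f xl xr => (P.transAtlas f xl xr).law

instance isProbabilityMeasure_sourceLaw (j : Source) : IsProbabilityMeasure (P.sourceLaw j) := by
  cases j with
  | mode σ => exact (P.modeAtlas σ).isProbabilityMeasure_law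
  | trans f xl xr => exact (P.transAtlas f xl xr).isProbabilityMeasure_law

/-- Independent samples, `N` from each source. Only the samples from sources that belong to the
given modes are used by the planner. -/
def configLaw (N : ℕ) : Measure (Source × Fin N → P.Config) :=
  Measure.infinitePi fun j => P.sourceLaw j.1

/-- The vertices of the roadmap: the start and the goal, the samples of each mode, and each
sampled transition as a vertex of both of its modes. -/
inductive IsVertex (S : Set Mode) {N : ℕ} (ω : Source × Fin N → P.Config) : P.State → Prop
  | start : IsVertex S ω P.start
  | goal : IsVertex S ω P.goal
  | sample (σ : Mode) (hσ : σ ∈ S) (i : Fin N) : IsVertex S ω (ω (.mode σ, i), σ)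
  | transSingle (f : Foot) (xl xr : Placement) (hs : Mode.single f (f.pick xl xr) ∈ S)
      (hd : Mode.double xl xr ∈ S) (i : Fin N) :
      IsVertex S ω (ω (.trans f xl xr, i), .single f (f.pick xl xr))
  | transDouble (f : Foot) (xl xr : Placement) (hs : Mode.single f (f.pick xl xr) ∈ S)
      (hd : Mode.double xl xr ∈ S) (i : Fin N) :
      IsVertex S ω (ω (.trans f xl xr, i), .double xl xr)

/-- The edges of the roadmap: local paths between vertices of one mode, and changes of mode at
vertices. -/
inductive IsEdge (S : Set Mode) {N : ℕ} (ω : Source × Fin N → P.Config) :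
    P.State → P.State → Prop
  | within (σ : Mode) (q q' : P.Config) (hσ : σ ∈ S) (hq : P.IsVertex S ω (q, σ))
      (hq' : P.IsVertex S ω (q', σ)) (h : (P.modeAtlas σ).Link q q') : IsEdge S ω (q, σ) (q', σ)
  | switch (q : P.Config) (σ τ : Mode) (hσ : σ ∈ S) (hτ : τ ∈ S) (hq : P.IsVertex S ω (q, σ))
      (hq' : P.IsVertex S ω (q, τ)) (h : P.Switch q σ τ) : IsEdge S ω (q, σ) (q, τ)

/-- The probability that multi-modal PRM with the modes `S`, and with `N` samples per mode and per
transition, finds no path from the start to the goal in its roadmap. -/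
def prmFailure (S : Set Mode) (N : ℕ) : ENNReal :=
  P.configLaw N {ω | ¬ Relation.ReflTransGen (P.IsEdge S ω) P.start P.goal}

/-! ### The pipeline

Each route found is handed to its own run of the later stages, and the runs for different routes are
independent given the pose samples. -/

/-- The probability that the first two stages fail: for no route found do the sampled modes admit a
feasible whole-body motion from the start to the goal. -/
def twoStageFailure (ρ : ℝ) (NP Nσ : ℕ) : ENNReal :=
  ∫⁻ p, ∏ T ∈ P.routes p,
    P.placementLaw ρ (p '' (T : Set (Fin NP))) Nσ
      {s | ¬ P.Connects (P.sampledModes s) P.start P.goal} ∂(P.poseLaw NP)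

/-- The probability that all three stages together find no solution. -/
def overallFailure (ρ : ℝ) (NP Nσ NM : ℕ) : ENNReal :=
  ∫⁻ p, ∏ T ∈ P.routes p,
    ∫⁻ s, P.prmFailure (P.sampledModes s) NM
      ∂(P.placementLaw ρ (p '' (T : Set (Fin NP))) Nσ) ∂(P.poseLaw NP)

/-! ### Cylinders of foot placements -/

/-- A robot standing on the foot `f` at `x` in configuration `q` can step to standing on the other
foot `g` at `y` in configuration `q'`. -/
def CanStep (f : Foot) (x : Placement) (q : P.Config) (g : Foot) (y : Placement)
    (q' : P.Config) : Prop :=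
  ∃ xl xr a b, f ≠ g ∧ f.pick xl xr = x ∧ g.pick xl xr = y ∧
    a ∈ P.feasible (.single f x) ∧ b ∈ P.feasible (.single g y) ∧
    JoinedIn (P.feasible (.single f x)) q a ∧
    JoinedIn (P.feasible (.double xl xr)) a b ∧
    JoinedIn (P.feasible (.single g y)) b q'

end Problem

/-- A cylinder of foot placements of positive radius and height: positions in a disc, yaw in an arc
of length `height`. -/
structure Cylinder where
  center : Placement
  radius : ℝ
  height : ℝ
  radius_pos : 0 < radius
  height_pos : 0 < height
  height_le : height ≤ 2 * Real.pi

def Cylinder.carrier (c : Cylinder) : Set Placement :=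
  Metric.closedBall c.center.1 c.radius ×ˢ Metric.closedBall c.center.2 (c.height / 2)

/-- Placements for `M` intermediate single-support modes that lead from the start to the goal, each
varying in a cylinder of positive volume, such that every placement of one cylinder is reachable
from every placement of the previous one. The zeroth region and the last one are the given start and
goal placements. Reachability is in the sense of a whole-body step between stances: `stance i x` is
a configuration for standing at `x` in the `i`-th single-support mode. -/
structure CylinderChain (P : Problem) (M : ℕ) where
  cyl : Fin M → Cylinder
  foot : Fin (M + 2) → Foot
  region : Fin (M + 2) → Set Placement
  stance : Fin (M + 2) → Placement → P.Config
  region_zero : region 0 = {P.xStart}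
  region_last : region (Fin.last (M + 1)) = {P.xGoal}
  region_mid : ∀ i : Fin M, region i.succ.castSucc = (cyl i).carrier
  foot_zero : foot 0 = P.footStart
  foot_last : foot (Fin.last (M + 1)) = P.footGoal
  stance_zero : stance 0 P.xStart = P.qStart
  stance_last : stance (Fin.last (M + 1)) P.xGoal = P.qGoal
  step : ∀ i : Fin (M + 1), ∀ x ∈ region i.castSucc, ∀ y ∈ region i.succ,
    P.CanStep (foot i.castSucc) x (stance i.castSucc x) (foot i.succ) y (stance i.succ y)

/-- `h_m`: the greatest horizontal distance to the path `γ` on `[0, L]` of a placement in one of the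
cylinders. -/
def CylinderChain.maxDist {P : Problem} {M : ℕ} (C : CylinderChain P M) (γ : ℝ → Pose)
    (L : ℝ) : ℝ :=
  sSup ((fun x : Placement => Metric.infDist x.1 ((fun s => xy (γ s)) '' Set.Icc 0 L)) ''
    ⋃ i, (C.cyl i).carrier)

/-- `R`: the least distance of the path `γ` on `[0, L]` to the outside of `C_N`. -/
def Problem.clearance (P : Problem) (γ : ℝ → Pose) (L : ℝ) : ℝ :=
  sInf ((fun s => Metric.infDist (γ s) P.CNᶜ) '' Set.Icc 0 L)

end WRPG

end

/-!
Each stage is shown to fail with exponentially small probability, and a union bound adds up the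
stages. Among the routes that are found a single suitable one is enough, since the runs for the
other routes can only lower the probability of failure (`lintegral_prod_routes_le`).

*Possibility exploration.* The path is followed by waypoints with spacing at most `ε`. Points of two
consecutive balls of radius `ε` around waypoints lie in one ball of radius `2 ε ≤ R`, hence are
joined by a segment in `C_N`. So a route is found as soon as each of the `⌈L / ε⌉ - 1` inner balls
contains a sample. Such a route stays within `2 ε ≤ ρ / 2` of the path, and the cylinders are within
`ρ / 2` of the path, so its sampling region covers all the cylinders
(`exists_exceptional_poses`).

*Mode sampling.* If each cylinder contains a sample of its own foot, the steps between consecutive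
cylinders concatenate to a motion through sampled modes (`CylinderChain.connects`). A sample
falls into a given cylinder with probability at least `r² Δθ / (2 A)`
(`placementLaw_not_connects_le`).

*Roadmap for fixed modes.* Near every point of a feasible space any two points are linked, in the
coordinates of a chart. Being connected by the roadmap robustly, that is whenever finitely many
regions of positive probability have been hit, is therefore a locally true and transitive relation,
so it holds along continuous motions and across changes of mode. Hence for fixed modes that admit a
motion, the roadmap planner fails with exponentially small probability (`exists_prmFailure_le`).

*Uniformity.* The rate of the roadmap planner depends on the placements. By the measurability
hypothesis the tuples of placements with a given rate form a measurable set, and countably many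
such sets exhaust the tuples from the cylinders, so one of them has positive measure. More modes
only help the planner, so it suffices that one of the disjoint blocks of `M` pairs of samples lies
in that set, and this fails with probability exponentially small in the number of blocks
(`exists_lintegral_prmFailure_le`).
-/

noncomputable section

namespace WRPG

open MeasureTheory Topology
open scoped ENNReal

/-! ### Sampling and linking near a point of a manifold -/

namespace FiniteAtlas

variable {n : ℕ} {F : Set (EuclideanSpace ℝ (Fin n))}

lemma exists_mem_nhdsWithin_link (A : FiniteAtlas F) {q : EuclideanSpace ℝ (Fin n)} (hq : q ∈ F) :
    ∃ W ∈ 𝓝[F] q, ∀ x ∈ W, ∀ y ∈ W, A.Link x y := by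
  obtain ⟨k, hk⟩ := A.covers ⟨q, hq⟩
  obtain ⟨r, hr, hball⟩ := Metric.isOpen_iff.1 (A.chart k).open_target _ ((A.chart k).map_source hk)
  have hW : (A.chart k).source ∩ A.chart k ⁻¹' Metric.ball (A.chart k ⟨q, hq⟩) r
      ∈ 𝓝 (⟨q, hq⟩ : F) :=
    Filter.inter_mem ((A.chart k).open_source.mem_nhds hk)
      ((A.chart k).continuousAt hk (Metric.ball_mem_nhds _ hr))
  refine ⟨_, map_nhds_subtype_val (⟨q, hq⟩ : F) ▸ Filter.image_mem_map hW, ?_⟩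
  rintro _ ⟨⟨x, hx⟩, hxW, rfl⟩ _ ⟨⟨y, hy⟩, hyW, rfl⟩
  exact ⟨k, hx, hy, hxW.1, hyW.1, ((convex_ball _ r).segment_subset hxW.2 hyW.2).trans hball⟩

/-- Every neighbourhood of a point is hit by a random configuration with positive probability. The
part that is hit is taken to be the image of a closed ball of a chart: it is compact, whence
measurable in the configuration space. -/
lemma exists_measurableSet_law_pos (A : FiniteAtlas F) {q : EuclideanSpace ℝ (Fin n)} (hq : q ∈ F)
    {U : Set (EuclideanSpace ℝ (Fin n))} (hU : U ∈ 𝓝[F] q) :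
    ∃ K ⊆ U, MeasurableSet K ∧ 0 < A.law K := by
  obtain ⟨k, hk⟩ := A.covers ⟨q, hq⟩
  set c := A.chart k
  set g : EuclideanSpace ℝ (Fin (A.dim k)) → EuclideanSpace ℝ (Fin n) :=
    fun u => ((c.symm u : F) : EuclideanSpace ℝ (Fin n))
  have hcont : ContinuousOn g c.target :=
    continuous_subtype_val.comp_continuousOn c.continuousOn_symm
  have hpre : g ⁻¹' U ∩ c.target ∈ 𝓝 (c ⟨q, hq⟩) := by
    refine Filter.inter_mem ?_ (c.open_target.mem_nhds (c.map_source hk))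
    have h1 : Subtype.val ⁻¹' U ∈ 𝓝 (⟨q, hq⟩ : F) := preimage_coe_mem_nhds_subtype.2 hU
    have h2 := c.continuousAt_symm (c.map_source hk)
    rw [ContinuousAt, c.left_inv hk] at h2
    exact h2 h1
  obtain ⟨r, hr, hball⟩ := Metric.nhds_basis_closedBall.mem_iff.1 hpre
  set B := Metric.closedBall (c ⟨q, hq⟩) r
  have hBt : B ⊆ c.target := fun u hu => (hball hu).2
  refine ⟨g '' B, ?_, ((isCompact_closedBall _ _).image_of_continuousOn
    (hcont.mono hBt)).measurableSet, ?_⟩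
  · rintro _ ⟨u, hu, rfl⟩
    exact (hball hu).1
  have hchart : 0 < A.chartLaw k (g '' B) := by
    have haem : AEMeasurable g (ProbabilityTheory.cond volume c.target) :=
      (hcont.aemeasurable c.open_target.measurableSet).smul_measure _
    refine lt_of_lt_of_le ?_ (Measure.le_map_apply haem (g '' B))
    refine lt_of_lt_of_le ?_ (measure_mono (Set.subset_preimage_image g B))
    rw [ProbabilityTheory.cond_apply c.open_target.measurableSet,
      Set.inter_eq_self_of_subset_right hBt]
    exact ENNReal.mul_pos (ENNReal.inv_ne_zero.2 (A.target_finite k).ne)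
      (Metric.measure_closedBall_pos volume _ hr).ne'
  have hne : A.numCharts ≠ 0 := fun h => (Fin.cast h k).elim0
  rw [law, if_neg hne, Measure.smul_apply, Measure.coe_finsetSum, Finset.sum_apply, smul_eq_mul]
  refine ENNReal.mul_pos (ENNReal.inv_ne_zero.2 (ENNReal.natCast_ne_top _)) (ne_of_gt ?_)
  exact hchart.trans_le (Finset.single_le_sum (f := fun j => A.chartLaw j (g '' B))
    (fun _ _ => zero_le) (Finset.mem_univ k))

end FiniteAtlas

namespace Problem

variable (P : Problem)

/-! ### Completeness of the multi-modal roadmap -/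

/-- The roadmap connects `s` to `s'` robustly: as soon as certain finitely many regions, each of
positive probability for its source, have been sampled, it connects every vertex near `s` in the
mode of `s` to every vertex near `s'` in the mode of `s'`. -/
def RobustlyConnected (S : Set Mode) (s s' : P.State) : Prop :=
  ∃ U ∈ 𝓝[P.feasible s.2] s.1, ∃ V ∈ 𝓝[P.feasible s'.2] s'.1,
    ∃ H : List (Source × Set P.Config),
      (∀ h ∈ H, MeasurableSet h.2 ∧ 0 < P.sourceLaw h.1 h.2) ∧
      ∀ (N : ℕ) (ω : Source × Fin N → P.Config), (∀ h ∈ H, ∃ i, ω (h.1, i) ∈ h.2) →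
        ∀ x ∈ U, ∀ y ∈ V, P.IsVertex S ω (x, s.2) → P.IsVertex S ω (y, s'.2) →
          Relation.ReflTransGen (P.IsEdge S ω) (x, s.2) (y, s'.2)

variable {P} {S : Set Mode}

/-- Robust connections compose: a sample of the middle mode in the intersection of the two
neighbourhoods of the middle state joins them. -/
lemma RobustlyConnected.trans {s t u : P.State} (ht : t.2 ∈ S) (htf : t.1 ∈ P.feasible t.2)
    (h₁ : P.RobustlyConnected S s t) (h₂ : P.RobustlyConnected S t u) :
    P.RobustlyConnected S s u := by
  obtain ⟨U₁, hU₁, V₁, hV₁, H₁, hH₁, c₁⟩ := h₁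
  obtain ⟨U₂, hU₂, V₂, hV₂, H₂, hH₂, c₂⟩ := h₂
  obtain ⟨K, hK, hKm, hKp⟩ :=
    (P.modeAtlas t.2).exists_measurableSet_law_pos htf (Filter.inter_mem hV₁ hU₂)
  refine ⟨U₁, hU₁, V₂, hV₂, (Source.mode t.2, K) :: (H₁ ++ H₂), ?_, ?_⟩
  · intro h hh
    rcases List.mem_cons.1 hh with rfl | hh
    · exact ⟨hKm, hKp⟩
    · exact (List.mem_append.1 hh).elim (hH₁ h) (hH₂ h)
  · intro N ω hω x hx y hy hxv hyv
    obtain ⟨i, hi⟩ := hω _ List.mem_cons_self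
    have hv : P.IsVertex S ω (ω (.mode t.2, i), t.2) := .sample t.2 ht i
    refine (c₁ N ω (fun h hh => hω h ?_) x hx _ (hK hi).1 hxv hv).trans
      (c₂ N ω (fun h hh => hω h ?_) _ (hK hi).2 y hy hv hyv) <;> simp [hh]

lemma robustlyConnected_of_joinedIn {σ : Mode} (hσ : σ ∈ S) {q q' : P.Config}
    (h : JoinedIn (P.feasible σ) q q') : P.RobustlyConnected S (q, σ) (q', σ) := by
  obtain ⟨γ, hγ⟩ := h
  have hrange : Set.range γ ⊆ P.feasible σ := Set.range_subset_iff.2 hγ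
  refine (isPreconnected_range γ.continuous).induction₂'
    (fun x y => P.RobustlyConnected S (x, σ) (y, σ)) (fun x hx => ?_)
    (fun x y z _ hy _ h₁ h₂ => h₁.trans hσ (hrange hy) h₂) ⟨0, γ.source⟩ ⟨1, γ.target⟩
  obtain ⟨W, hW, hlink⟩ := (P.modeAtlas σ).exists_mem_nhdsWithin_link (hrange hx)
  have hev : ∀ᶠ y in 𝓝[Set.range γ] x, W ∈ 𝓝[P.feasible σ] y ∧ y ∈ P.feasible σ :=
    (((eventually_mem_nhdsWithin_iff).2 hW).and self_mem_nhdsWithin).filter_mono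
      (nhdsWithin_mono x hrange)
  filter_upwards [hev] with y hy
  constructor
  · exact ⟨W, hW, W, hy.1, [], by simp, fun N ω _ a ha b hb hav hbv =>
      .single (.within σ a b hσ hav hbv (hlink a ha b hb))⟩
  · exact ⟨W, hy.1, W, hW, [], by simp, fun N ω _ a ha b hb hav hbv =>
      .single (.within σ a b hσ hav hbv (hlink a ha b hb))⟩

/-- A change of mode at `q` is robust: it can be replaced by a sampled transition near `q`, since
nearby transitions are close to `q` in the feasible spaces of both modes. -/
lemma robustlyConnected_of_switch {σ τ : Mode} (hσ : σ ∈ S) (hτ : τ ∈ S) {q : P.Config}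
    (h : P.Switch q σ τ) : P.RobustlyConnected S (q, σ) (q, τ) := by
  have key : ∀ (f : Foot) (xl xr : Placement) (hs : Mode.single f (f.pick xl xr) ∈ S)
      (hd : Mode.double xl xr ∈ S) (hqs : q ∈ P.feasible (.single f (f.pick xl xr)))
      (hqd : q ∈ P.feasible (.double xl xr)),
      P.RobustlyConnected S (q, .single f (f.pick xl xr)) (q, .double xl xr) ∧
        P.RobustlyConnected S (q, .double xl xr) (q, .single f (f.pick xl xr)) := by
    intro f xl xr hs hd hqs hqd
    obtain ⟨W₁, hW₁, l₁⟩ := (P.modeAtlas (.single f (f.pick xl xr))).exists_mem_nhdsWithin_link hqs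
    obtain ⟨W₂, hW₂, l₂⟩ := (P.modeAtlas (.double xl xr)).exists_mem_nhdsWithin_link hqd
    -- intersecting with the transition manifold itself makes every point of `K` a transition
    obtain ⟨K, hK, hKm, hKp⟩ := (P.transAtlas f xl xr).exists_measurableSet_law_pos ⟨hqs, hqd⟩
      (Filter.inter_mem (Filter.inter_mem (nhdsWithin_mono q Set.inter_subset_left hW₁)
        (nhdsWithin_mono q Set.inter_subset_right hW₂)) self_mem_nhdsWithin)
    have hH : ∀ h ∈ [(Source.trans f xl xr, K)],
        MeasurableSet h.2 ∧ 0 < P.sourceLaw h.1 h.2 := by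
      intro h hh
      rw [List.mem_singleton.1 hh]
      exact ⟨hKm, hKp⟩
    refine ⟨⟨W₁, hW₁, W₂, hW₂, _, hH, ?_⟩, ⟨W₂, hW₂, W₁, hW₁, _, hH, ?_⟩⟩
    · intro N ω hω x hx y hy hxv hyv
      obtain ⟨i, hi⟩ := hω _ List.mem_cons_self
      obtain ⟨⟨ha₁, ha₂⟩, hfs, hfd⟩ := hK hi
      have v₁ := IsVertex.transSingle (ω := ω) f xl xr hs hd i
      have v₂ := IsVertex.transDouble (ω := ω) f xl xr hs hd i
      exact ((Relation.ReflTransGen.single (.within _ x _ hs hxv v₁ (l₁ _ hx _ ha₁))).tail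
        (.switch _ _ _ hs hd v₁ v₂ (.land f xl xr hfs hfd))).tail
        (.within _ _ y hd v₂ hyv (l₂ _ ha₂ _ hy))
    · intro N ω hω x hx y hy hxv hyv
      obtain ⟨i, hi⟩ := hω _ List.mem_cons_self
      obtain ⟨⟨ha₁, ha₂⟩, hfs, hfd⟩ := hK hi
      have v₁ := IsVertex.transSingle (ω := ω) f xl xr hs hd i
      have v₂ := IsVertex.transDouble (ω := ω) f xl xr hs hd i
      exact ((Relation.ReflTransGen.single (.within _ x _ hd hxv v₂ (l₂ _ hx _ ha₂))).tail
        (.switch _ _ _ hd hs v₂ v₁ (.lift f xl xr hfs hfd))).tail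
        (.within _ _ y hs v₁ hyv (l₁ _ ha₁ _ hy))
  cases h with
  | lift f xl xr hs hd => exact (key f xl xr hτ hσ hs hd).2
  | land f xl xr hs hd => exact (key f xl xr hσ hτ hs hd).1

lemma Switch.mem_feasible {q : P.Config} {σ τ : Mode} (h : P.Switch q σ τ) :
    q ∈ P.feasible σ ∧ q ∈ P.feasible τ := by
  cases h with
  | lift f xl xr hs hd => exact ⟨hd, hs⟩
  | land f xl xr hs hd => exact ⟨hs, hd⟩

lemma Move.robustlyConnected {s s' : P.State} (h : P.Move S s s') :
    P.RobustlyConnected S s s' ∧ (s.2 ∈ S ∧ s.1 ∈ P.feasible s.2) ∧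
      s'.2 ∈ S ∧ s'.1 ∈ P.feasible s'.2 := by
  cases h with
  | within σ q q' hσ h =>
    exact ⟨robustlyConnected_of_joinedIn hσ h, ⟨hσ, h.source_mem⟩, hσ, h.target_mem⟩
  | switch q σ τ hσ hτ h =>
    exact ⟨robustlyConnected_of_switch hσ hτ h, ⟨hσ, h.mem_feasible.1⟩, hτ, h.mem_feasible.2⟩

lemma robustlyConnected_of_transGen {s s' : P.State} (h : Relation.TransGen (P.Move S) s s') :
    P.RobustlyConnected S s s' ∧ (s.2 ∈ S ∧ s.1 ∈ P.feasible s.2) ∧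
      s'.2 ∈ S ∧ s'.1 ∈ P.feasible s'.2 := by
  induction h with
  | single h => exact h.robustlyConnected
  | tail _ h ih =>
    obtain ⟨r, hs, ht, htf⟩ := ih
    obtain ⟨r', -, hu⟩ := h.robustlyConnected
    exact ⟨r.trans ht htf r', hs, hu⟩

lemma exists_regions_of_connects (h : P.Connects S P.start P.goal) :
    ∃ H : List (Source × Set P.Config),
      (∀ h ∈ H, MeasurableSet h.2 ∧ 0 < P.sourceLaw h.1 h.2) ∧
      ∀ (N : ℕ) (ω : Source × Fin N → P.Config), (∀ h ∈ H, ∃ i, ω (h.1, i) ∈ h.2) →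
        Relation.ReflTransGen (P.IsEdge S ω) P.start P.goal := by
  rcases Relation.reflTransGen_iff_eq_or_transGen.1 h with h | h
  · exact ⟨[], by simp, fun N ω _ => h ▸ .refl⟩
  · obtain ⟨⟨U, hU, V, hV, H, hH, c⟩, ⟨-, hs⟩, -, hg⟩ := robustlyConnected_of_transGen h
    exact ⟨H, hH, fun N ω hω => c N ω hω _ (mem_of_mem_nhdsWithin hs hU) _
      (mem_of_mem_nhdsWithin hg hV) .start .goal⟩

end Problem

/-! ### Independent samples -/

section Sampling

variable {Ω : Type*} [MeasurableSpace Ω]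

lemma measure_compl_pow_le (μ : Measure Ω) [IsProbabilityMeasure μ] {A : Set Ω}
    (hA : MeasurableSet A) {c : ℝ} (hc : ENNReal.ofReal c ≤ μ A) (N : ℕ) :
    μ Aᶜ ^ N ≤ ENNReal.ofReal (Real.exp (-(c * N))) := by
  have h1 : μ Aᶜ ≤ ENNReal.ofReal (Real.exp (-c)) := by
    rw [prob_compl_eq_one_sub hA]
    rcases le_total c 0 with h | h
    · refine tsub_le_self.trans ?_
      rw [← ENNReal.ofReal_one]
      exact ENNReal.ofReal_le_ofReal (Real.one_le_exp (by linarith))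
    · calc 1 - μ A ≤ 1 - ENNReal.ofReal c := tsub_le_tsub_left hc _
        _ = ENNReal.ofReal (1 - c) := by rw [ENNReal.ofReal_sub _ h, ENNReal.ofReal_one]
        _ ≤ _ := ENNReal.ofReal_le_ofReal (by linarith [Real.add_one_le_exp (-c)])
  calc μ Aᶜ ^ N ≤ ENNReal.ofReal (Real.exp (-c)) ^ N := by gcongr
    _ = _ := by
      rw [← ENNReal.ofReal_pow (Real.exp_pos _).le, ← Real.exp_nat_mul]
      congr 2
      ring

lemma pi_forall_notMem_le (μ : Measure Ω) [IsProbabilityMeasure μ] {A : Set Ω}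
    (hA : MeasurableSet A) {c : ℝ} (hc : ENNReal.ofReal c ≤ μ A) (N : ℕ) :
    Measure.pi (fun _ : Fin N => μ) {p | ∀ k, p k ∉ A} ≤
      ENNReal.ofReal (Real.exp (-(c * N))) := by
  have : {p : Fin N → Ω | ∀ k, p k ∉ A} = Set.univ.pi fun _ => Aᶜ := by ext; simp
  rw [this, Measure.pi_pi, Finset.prod_const, Finset.card_univ, Fintype.card_fin]
  exact measure_compl_pow_le μ hA hc N

lemma measure_pi_mono {ι : Type*} [Fintype ι] {μ ν : ι → Measure Ω} [∀ i, SigmaFinite (μ i)]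
    (h : ∀ i, μ i ≤ ν i) : Measure.pi μ ≤ Measure.pi ν := by
  refine Measure.le_iff.2 fun s hs => ?_
  have key : (Measure.pi μ).toOuterMeasure ≤ OuterMeasure.pi fun i => (ν i).toOuterMeasure := by
    refine OuterMeasure.le_pi.2 fun t _ => ?_
    change Measure.pi μ (Set.univ.pi t) ≤ ∏ i, ν i (t i)
    rw [Measure.pi_pi]
    exact Finset.prod_le_prod' fun i _ => h i (t i)
  refine (key s).trans (le_of_eq ?_)
  rw [Measure.pi, toMeasure_apply _ _ hs]

/-- The coordinates of independent identically distributed samples along disjoint blocks form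
independent blocks of independent samples. -/
lemma pi_map_blocks (μ : Measure Ω) [IsProbabilityMeasure μ] {N q m : ℕ}
    (e : Fin q × Fin m ↪ Fin N) :
    (Measure.pi fun _ : Fin N => μ).map (fun t b j => t (e (b, j))) =
      Measure.pi fun _ : Fin q => Measure.pi fun _ : Fin m => μ := by
  have hind := (ProbabilityTheory.iIndepFun_pi (μ := fun _ : Fin N => μ)
    (X := fun _ x => x) (fun _ => aemeasurable_id)).precomp e.injective
  have h1 : (Measure.pi fun _ : Fin N => μ).map (fun t (j : Fin q × Fin m) => t (e j)) =
      Measure.pi fun _ : Fin q × Fin m => μ := by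
    have := hind.map_fun_eq_pi_map (fun j => (measurable_pi_apply _).aemeasurable)
    refine this.trans ?_
    congr 1
    ext1 j
    exact (measurePreserving_eval (fun _ : Fin N => μ) (e j)).map_eq
  have h2 := Measure.infinitePi_map_curry (ι := Fin q) (κ := Fin m) (fun _ _ => μ)
  have h3 : (fun (t : Fin N → Ω) b j => t (e (b, j))) =
      (MeasurableEquiv.curry (Fin q) (Fin m) Ω) ∘ (fun t j => t (e j)) := rfl
  rw [h3, ← Measure.map_map (MeasurableEquiv.measurable _) (by fun_prop), h1]
  simpa [Measure.infinitePi_eq_pi] using h2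

lemma pi_forall_blocks_notMem_le (μ : Measure Ω) [IsProbabilityMeasure μ] {N q m : ℕ}
    (e : Fin q × Fin m ↪ Fin N) {E : Set (Fin m → Ω)} (hE : MeasurableSet E) {c : ℝ}
    (hc : ENNReal.ofReal c ≤ Measure.pi (fun _ => μ) E) :
    Measure.pi (fun _ : Fin N => μ) {t | ∀ b, (fun j => t (e (b, j))) ∉ E} ≤
      ENNReal.ofReal (Real.exp (-(c * q))) := by
  have hms : MeasurableSet {u : Fin q → Fin m → Ω | ∀ b, u b ∉ E} := by
    rw [Set.ofPred_forall]
    exact MeasurableSet.iInter fun b => (measurable_pi_apply b hE).compl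
  refine le_trans (le_of_eq ?_) (pi_forall_notMem_le _ hE hc q)
  rw [← pi_map_blocks μ e, Measure.map_apply (by fun_prop) hms]
  rfl

end Sampling

namespace Problem

variable {P : Problem} {S : Set Mode}

/-- If the modes `S` admit a motion from the start to the goal, the roadmap planner with these modes
fails with exponentially small probability. The same natural number bounds the factor and the
inverse rate. -/
lemma exists_prmFailure_le (h : P.Connects S P.start P.goal) :
    ∃ K : ℕ, ∀ N : ℕ, P.prmFailure S N ≤
      ENNReal.ofReal (K * Real.exp (-(1 / ((K : ℝ) + 1) * N))) := by
  classical
  obtain ⟨H, hH, c⟩ := exists_regions_of_connects h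
  have hlim : Filter.Tendsto (fun K : ℕ => ENNReal.ofReal (1 / ((K : ℝ) + 1))) Filter.atTop
      (𝓝 0) := by
    simpa using ENNReal.tendsto_ofReal tendsto_one_div_add_atTop_nhds_zero_nat
  have hev : ∀ᶠ K : ℕ in Filter.atTop, ∀ h ∈ H.toFinset,
      ENNReal.ofReal (1 / ((K : ℝ) + 1)) ≤ P.sourceLaw h.1 h.2 := by
    rw [Filter.eventually_all_finset]
    intro h hh
    exact (hlim.eventually_lt_const (hH h (List.mem_toFinset.1 hh)).2).mono fun _ => le_of_lt
  obtain ⟨K, hK, hKc⟩ := (hev.and (Filter.eventually_ge_atTop H.toFinset.card)).exists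
  refine ⟨K, fun N => ?_⟩
  have hsub : {ω : Source × Fin N → P.Config |
      ¬ Relation.ReflTransGen (P.IsEdge S ω) P.start P.goal} ⊆
      ⋃ h ∈ H.toFinset, {ω | ∀ i, ω (h.1, i) ∉ h.2} := by
    intro ω hω
    by_contra hcon
    refine hω (c N ω fun h hh => ?_)
    by_contra! hne
    exact hcon (Set.mem_biUnion (List.mem_toFinset.2 hh) hne)
  have hone : ∀ h ∈ H.toFinset, P.configLaw N {ω | ∀ i, ω (h.1, i) ∉ h.2} ≤
      ENNReal.ofReal (Real.exp (-(1 / ((K : ℝ) + 1) * N))) := by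
    intro h hh
    have hm := (hH h (List.mem_toFinset.1 hh)).1
    have hset : {ω : Source × Fin N → P.Config | ∀ i, ω (h.1, i) ∉ h.2} =
        ((Finset.univ.image fun i : Fin N => (h.1, i) : Finset (Source × Fin N)) :
          Set (Source × Fin N)).pi fun _ => h.2ᶜ := by
      ext ω
      simp [Set.pi]
    rw [hset, configLaw, Measure.infinitePi_pi _ fun _ _ => hm.compl,
      Finset.prod_image fun i _ j _ hij => (Prod.ext_iff.1 hij).2]
    change ∏ _i : Fin N, P.sourceLaw h.1 h.2ᶜ ≤ _
    rw [Finset.prod_const, Finset.card_univ, Fintype.card_fin]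
    exact measure_compl_pow_le _ hm (hK h hh) N
  calc P.prmFailure S N ≤ ∑ h ∈ H.toFinset, P.configLaw N {ω | ∀ i, ω (h.1, i) ∉ h.2} :=
        (measure_mono hsub).trans (measure_biUnion_finset_le _ _)
    _ ≤ H.toFinset.card • ENNReal.ofReal (Real.exp (-(1 / ((K : ℝ) + 1) * N))) :=
        Finset.sum_le_card_nsmul _ _ _ hone
    _ ≤ K • ENNReal.ofReal (Real.exp (-(1 / ((K : ℝ) + 1) * N))) := by gcongr
    _ = _ := by rw [nsmul_eq_mul, ENNReal.ofReal_mul (Nat.cast_nonneg _), ENNReal.ofReal_natCast]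

lemma IsVertex.mono {S' : Set Mode} (hS : S ⊆ S') {N : ℕ} {ω : Source × Fin N → P.Config}
    {s : P.State} (h : P.IsVertex S ω s) : P.IsVertex S' ω s := by
  cases h with
  | start => exact .start
  | goal => exact .goal
  | sample σ hσ i => exact .sample σ (hS hσ) i
  | transSingle f xl xr hs hd i => exact .transSingle f xl xr (hS hs) (hS hd) i
  | transDouble f xl xr hs hd i => exact .transDouble f xl xr (hS hs) (hS hd) i

lemma IsEdge.mono {S' : Set Mode} (hS : S ⊆ S') {N : ℕ} {ω : Source × Fin N → P.Config}
    {s s' : P.State} (h : P.IsEdge S ω s s') : P.IsEdge S' ω s s' := by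
  cases h with
  | within σ q q' hσ hq hq' h => exact .within σ q q' (hS hσ) (hq.mono hS) (hq'.mono hS) h
  | switch q σ τ hσ hτ hq hq' h =>
    exact .switch q σ τ (hS hσ) (hS hτ) (hq.mono hS) (hq'.mono hS) h

lemma prmFailure_anti {S' : Set Mode} (hS : S ⊆ S') (N : ℕ) :
    P.prmFailure S' N ≤ P.prmFailure S N :=
  measure_mono fun _ hω h => hω (Relation.ReflTransGen.mono (fun _ _ => IsEdge.mono hS) _ _ h)

instance isProbabilityMeasure_configLaw (N : ℕ) : IsProbabilityMeasure (P.configLaw N) := by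
  unfold configLaw
  infer_instance

lemma prmFailure_le_one (S : Set Mode) (N : ℕ) : P.prmFailure S N ≤ 1 := prob_le_one

/-! ### Walking through sampled placements -/

lemma sampledModes_comp_subset {N m : ℕ} (s : (Fin N → Placement) × (Fin N → Placement))
    (g : Fin m → Fin N) : P.sampledModes (s.1 ∘ g, s.2 ∘ g) ⊆ P.sampledModes s := by
  have hav : ∀ f, P.available (s.1 ∘ g, s.2 ∘ g) f ⊆ P.available s f := by
    rintro f x (⟨i, rfl⟩ | h)
    · exact Or.inl ⟨g i, rfl⟩
    · exact Or.inr h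
  rintro σ h
  cases h with
  | single f x hx hv => exact .single f x (hav f hx) hv
  | double xl xr hl hr h => exact .double xl xr (hav _ hl) (hav _ hr) h

lemma CanStep.connects {N : ℕ} {s : (Fin N → Placement) × (Fin N → Placement)} {f g : Foot}
    {x y : Placement} {q q' : P.Config} (hx : x ∈ P.available s f) (hy : y ∈ P.available s g)
    (h : P.CanStep f x q g y q') :
    P.Connects (P.sampledModes s) (q, .single f x) (q', .single g y) := by
  obtain ⟨xl, xr, a, b, hne, rfl, rfl, ha, hb, h₁, h₂, h₃⟩ := h
  have m₁ : Mode.single f (f.pick xl xr) ∈ P.sampledModes s := .single _ _ hx ⟨a, ha⟩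
  have m₂ : Mode.single g (g.pick xl xr) ∈ P.sampledModes s := .single _ _ hy ⟨b, hb⟩
  have m : Mode.double xl xr ∈ P.sampledModes s := by
    cases f <;> cases g
    · exact absurd rfl hne
    · exact .double _ _ hx hy ⟨⟨a, ha, h₂.source_mem⟩, ⟨b, hb, h₂.target_mem⟩⟩
    · exact .double _ _ hy hx ⟨⟨b, hb, h₂.target_mem⟩, ⟨a, ha, h₂.source_mem⟩⟩
    · exact absurd rfl hne
  refine ((((Relation.ReflTransGen.single (Move.within _ _ _ m₁ h₁)).tail
    (Move.switch _ _ _ m₁ m (.land _ _ _ ha h₂.source_mem))).tail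
    (Move.within _ _ _ m h₂)).tail
    (Move.switch _ _ _ m m₂ (.lift _ _ _ hb h₂.target_mem))).tail (Move.within _ _ _ m₂ h₃)

end Problem

/-- If every cylinder contains a sampled placement of its own foot, then the sampled modes admit a
motion from the start to the goal. -/
lemma CylinderChain.connects {P : Problem} {M : ℕ} (C : CylinderChain P M) {N : ℕ}
    (s : (Fin N → Placement) × (Fin N → Placement))
    (hs : ∀ i : Fin M, ∃ k, (C.foot i.succ.castSucc).pick (s.1 k) (s.2 k) ∈ (C.cyl i).carrier) :
    P.Connects (P.sampledModes s) P.start P.goal := by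
  have hex : ∀ j : Fin (M + 2), ∃ x, x ∈ C.region j ∧ x ∈ P.available s (C.foot j) := by
    intro j
    induction j using Fin.cases with
    | zero =>
      exact ⟨P.xStart, by rw [C.region_zero]; rfl, Or.inr (Or.inl ⟨C.foot_zero, rfl⟩)⟩
    | succ j =>
      induction j using Fin.lastCases with
      | last =>
        rw [Fin.succ_last]
        exact ⟨P.xGoal, by rw [C.region_last]; rfl, Or.inr (Or.inr ⟨C.foot_last, rfl⟩)⟩
      | cast i =>
        rw [← Fin.castSucc_succ]
        obtain ⟨k, hk⟩ := hs i
        exact ⟨_, by rw [C.region_mid]; exact hk, Or.inl ⟨k, rfl⟩⟩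
  choose x hx hxa using hex
  have hx0 : x 0 = P.xStart := by simpa [C.region_zero] using hx 0
  have hxl : x (Fin.last (M + 1)) = P.xGoal := by simpa [C.region_last] using hx (Fin.last _)
  have hconn : ∀ j : Fin (M + 2), P.Connects (P.sampledModes s) P.start
      (C.stance j (x j), .single (C.foot j) (x j)) := by
    intro j
    induction j using Fin.induction with
    | zero =>
      rw [hx0, C.stance_zero, C.foot_zero]
      exact .refl
    | succ i ih =>
      exact ih.trans ((C.step i _ (hx _) _ (hx _)).connects (hxa _) (hxa _))
  have := hconn (Fin.last _)
  rwa [hxl, C.stance_last, C.foot_last] at this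

/-! ### The path through the exploration space and its waypoints -/

lemma dist_xy_le (p q : Pose) : dist (xy p) (xy q) ≤ dist p q := by
  rw [EuclideanSpace.dist_eq, EuclideanSpace.dist_eq]
  refine Real.sqrt_le_sqrt ?_
  simp only [xy, Fin.sum_univ_succ, Fin.sum_univ_zero]
  simp
  positivity

lemma lipschitzWith_xy : LipschitzWith 1 xy := LipschitzWith.of_dist_le_mul fun p q => by
  simpa using dist_xy_le p q

lemma dist_le_of_hasUnitSpeedOn {γ : ℝ → Pose} {L s t : ℝ} (hγ : HasUnitSpeedOn γ (Set.Icc 0 L))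
    (hs : s ∈ Set.Icc 0 L) (ht : t ∈ Set.Icc 0 L) (hst : s ≤ t) :
    dist (γ s) (γ t) ≤ t - s := by
  have h := eVariationOn.edist_le γ (s := Set.Icc 0 L ∩ Set.Icc s t)
    ⟨hs, le_rfl, hst⟩ ⟨ht, hst, le_rfl⟩
  rw [hγ hs ht, edist_dist] at h
  simpa using (ENNReal.ofReal_le_ofReal_iff (by simpa using hst)).1 h

lemma continuousOn_of_hasUnitSpeedOn {γ : ℝ → Pose} {L : ℝ}
    (hγ : HasUnitSpeedOn γ (Set.Icc 0 L)) : ContinuousOn γ (Set.Icc 0 L) := by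
  refine LipschitzOnWith.continuousOn (K := 1) (LipschitzOnWith.of_dist_le_mul fun s hs t ht => ?_)
  rw [NNReal.coe_one, one_mul, Real.dist_eq]
  rcases le_total s t with h | h
  · rw [abs_sub_comm, abs_of_nonneg (sub_nonneg.2 h)]
    exact dist_le_of_hasUnitSpeedOn hγ hs ht h
  · rw [dist_comm, abs_of_nonneg (sub_nonneg.2 h)]
    exact dist_le_of_hasUnitSpeedOn hγ ht hs h

/-- The time at which the path passes its `j`-th waypoint: waypoints are spaced by `ε`, except for
the last ones, which are the end of the path. -/
def wayTime (L ε : ℝ) (j : ℕ) : ℝ := min (j * ε) L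

section WayTime

variable {L ε : ℝ}

lemma wayTime_mem (hL : 0 ≤ L) (hε : 0 < ε) (j : ℕ) : wayTime L ε j ∈ Set.Icc 0 L :=
  ⟨le_min (by positivity) hL, min_le_right _ _⟩

lemma wayTime_zero (hL : 0 ≤ L) : wayTime L ε 0 = 0 := by simp [wayTime, hL]

lemma wayTime_last (hε : 0 < ε) : wayTime L ε (⌈L / ε⌉₊ - 1 + 1) = L := by
  refine min_eq_right ?_
  have h1 : (⌈L / ε⌉₊ : ℝ) ≤ ((⌈L / ε⌉₊ - 1 + 1 : ℕ) : ℝ) := by exact_mod_cast (by omega)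
  rw [← div_le_iff₀ hε]
  exact (Nat.le_ceil _).trans h1

lemma wayTime_le_succ (hε : 0 < ε) (j : ℕ) : wayTime L ε j ≤ wayTime L ε (j + 1) := by
  unfold wayTime
  push_cast
  gcongr
  linarith

lemma wayTime_succ_le (hε : 0 < ε) (j : ℕ) : wayTime L ε (j + 1) - wayTime L ε j ≤ ε := by
  have : wayTime L ε (j + 1) ≤ wayTime L ε j + ε := by
    unfold wayTime
    rw [← min_add_add_right]
    push_cast
    exact min_le_min (by linarith) (by linarith)
  linarith

lemma exists_wayTime_le (hε : 0 < ε) {s : ℝ} (hs : s ∈ Set.Icc 0 L) :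
    ∃ j ≤ ⌈L / ε⌉₊ - 1 + 1, wayTime L ε j ≤ s ∧ s - wayTime L ε j ≤ ε := by
  have h0 : 0 ≤ s / ε := div_nonneg hs.1 hε.le
  refine ⟨⌊s / ε⌋₊, ?_, ?_, ?_⟩
  · have : ⌊s / ε⌋₊ ≤ ⌈L / ε⌉₊ :=
      (Nat.floor_le_ceil _).trans (Nat.ceil_mono (div_le_div_of_nonneg_right hs.2 hε.le))
    omega
  · exact (min_le_left _ _).trans ((le_div_iff₀ hε).1 (Nat.floor_le h0))
  · have := (div_lt_iff₀ hε).1 (Nat.lt_floor_add_one (s / ε))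
    rw [wayTime, sub_le_comm]
    exact le_min (by linarith) (by linarith [hs.2])

end WayTime

namespace Problem

variable {P : Problem}

lemma ball_clearance_subset {γ : ℝ → Pose} {L s : ℝ} (hs : s ∈ Set.Icc 0 L) :
    Metric.ball (γ s) (P.clearance γ L) ⊆ P.CN := by
  intro y hy
  by_contra hcon
  have h1 : P.clearance γ L ≤ Metric.infDist (γ s) P.CNᶜ :=
    csInf_le ⟨0, by rintro _ ⟨t, -, rfl⟩; exact Metric.infDist_nonneg⟩ ⟨s, hs, rfl⟩
  have h2 := Metric.infDist_le_dist_of_mem (x := γ s) (show y ∈ P.CNᶜ from hcon)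
  rw [Metric.mem_ball, dist_comm] at hy
  linarith

lemma volume_CN_lt_top : volume P.CN < ∞ := by
  have hc : IsCompact {p : Pose | ∀ i, P.lo i ≤ p i ∧ p i ≤ P.hi i} := by
    have := (EuclideanSpace.equiv (Fin 6) ℝ).toHomeomorph.isCompact_preimage.2
      (isCompact_univ_pi fun i => isCompact_Icc (a := P.lo i) (b := P.hi i))
    convert this using 1
    ext p
    simp only [Set.mem_preimage, Set.mem_univ_pi, Set.mem_Icc]
    rfl
  exact (measure_mono P.CN_subset).trans_lt hc.measure_lt_top

/-- A list of poses that follow the waypoints with an error less than `ε` is a route: consecutive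
poses lie in a common ball of radius `2 ε` around a waypoint. -/
lemma isRoute_ofFn {γ : ℝ → Pose} {L ε : ℝ} (hL : 0 ≤ L) (hε : 0 < ε)
    (hγ : HasUnitSpeedOn γ (Set.Icc 0 L)) (hγ0 : γ 0 = P.pStart) (hγL : γ L = P.pGoal)
    (hεR : 2 * ε ≤ P.clearance γ L) (v : Fin (⌈L / ε⌉₊ - 1) → Pose)
    (hv : ∀ j, dist (v j) (γ (wayTime L ε (j + 1))) < ε) : P.IsRoute (List.ofFn v) := by
  have key : ∀ i (hi : i < (P.pStart :: (List.ofFn v ++ [P.pGoal])).length),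
      dist ((P.pStart :: (List.ofFn v ++ [P.pGoal]))[i]) (γ (wayTime L ε i)) < ε := by
    intro i hi
    rcases i with _ | i
    · simpa [wayTime_zero hL, hγ0] using hε
    · rw [List.getElem_cons_succ]
      rcases lt_or_ge i (⌈L / ε⌉₊ - 1) with h | h
      · rw [List.getElem_append_left (by simpa using h), List.getElem_ofFn]
        exact hv ⟨i, h⟩
      · have hi' : i = ⌈L / ε⌉₊ - 1 := by
          simp at hi
          omega
        subst hi'
        rw [List.getElem_append_right (by simp), wayTime_last hε, hγL]
        simpa using hε
  refine List.isChain_iff_getElem.2 fun i hi => ?_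
  have h0 := key i (by omega)
  have h1 := key (i + 1) hi
  have hd := (dist_le_of_hasUnitSpeedOn hγ (wayTime_mem hL hε i) (wayTime_mem hL hε (i + 1))
    (wayTime_le_succ hε i)).trans (wayTime_succ_le hε i)
  refine (((convex_ball (γ (wayTime L ε i)) (2 * ε)).segment_subset ?_ ?_).trans
    (Metric.ball_subset_ball hεR)).trans (ball_clearance_subset (wayTime_mem hL hε i))
  · rw [Metric.mem_ball]
    linarith
  · rw [Metric.mem_ball]
    linarith [dist_triangle ((P.pStart :: (List.ofFn v ++ [P.pGoal]))[i + 1])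
      (γ (wayTime L ε (i + 1))) (γ (wayTime L ε i)),
      dist_comm (γ (wayTime L ε (i + 1))) (γ (wayTime L ε i))]

lemma exists_vertex_near {γ : ℝ → Pose} {L ε : ℝ} (hL : 0 ≤ L) (hε : 0 < ε)
    (hγ : HasUnitSpeedOn γ (Set.Icc 0 L)) (hγ0 : γ 0 = P.pStart) (hγL : γ L = P.pGoal)
    (v : Fin (⌈L / ε⌉₊ - 1) → Pose) (hv : ∀ j, dist (v j) (γ (wayTime L ε (j + 1))) < ε)
    {s : ℝ} (hs : s ∈ Set.Icc 0 L) :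
    ∃ w ∈ insert P.pStart (insert P.pGoal (Set.range v)), dist (γ s) w ≤ 2 * ε := by
  obtain ⟨j, hj, hjs, hsj⟩ := exists_wayTime_le hε hs
  have hd : dist (γ s) (γ (wayTime L ε j)) ≤ ε := by
    rw [dist_comm]
    exact (dist_le_of_hasUnitSpeedOn hγ (wayTime_mem hL hε j) hs hjs).trans hsj
  rcases j with _ | j
  · refine ⟨P.pStart, by simp, ?_⟩
    rw [wayTime_zero hL, hγ0] at hd
    linarith
  · rcases lt_or_ge j (⌈L / ε⌉₊ - 1) with h | h
    · refine ⟨v ⟨j, h⟩, by simp, ?_⟩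
      have := hv ⟨j, h⟩
      rw [dist_comm] at this
      linarith [dist_triangle (γ s) (γ (wayTime L ε (j + 1))) (v ⟨j, h⟩)]
    · refine ⟨P.pGoal, by simp, ?_⟩
      have hj' : j = ⌈L / ε⌉₊ - 1 := by omega
      rw [hj', wayTime_last hε, hγL] at hd
      linarith

end Problem

/-! ### Cylinders inside the sampling region of a route -/

lemma CylinderChain.infDist_le_maxDist {P : Problem} {M : ℕ} (C : CylinderChain P M)
    {γ : ℝ → Pose} {L : ℝ} (hL : 0 ≤ L) {i : Fin M} {x : Placement}
    (hx : x ∈ (C.cyl i).carrier) :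
    Metric.infDist x.1 ((fun s => xy (γ s)) '' Set.Icc 0 L) ≤ C.maxDist γ L := by
  refine le_csSup ?_ ⟨x, Set.mem_iUnion.2 ⟨i, hx⟩, rfl⟩
  have h0 : xy (γ 0) ∈ (fun s => xy (γ s)) '' Set.Icc 0 L := ⟨0, ⟨le_rfl, hL⟩, rfl⟩
  refine ⟨∑ i, (dist (C.cyl i).center.1 (xy (γ 0)) + (C.cyl i).radius), ?_⟩
  rintro _ ⟨y, hy, rfl⟩
  obtain ⟨j, hj⟩ := Set.mem_iUnion.1 hy
  have hj1 : dist y.1 (C.cyl j).center.1 ≤ (C.cyl j).radius := hj.1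
  calc Metric.infDist y.1 _ ≤ dist y.1 (xy (γ 0)) := Metric.infDist_le_dist_of_mem h0
    _ ≤ dist (C.cyl j).center.1 (xy (γ 0)) + (C.cyl j).radius := by
      linarith [dist_triangle y.1 (C.cyl j).center.1 (xy (γ 0))]
    _ ≤ _ := Finset.single_le_sum
      (f := fun i => dist (C.cyl i).center.1 (xy (γ 0)) + (C.cyl i).radius)
      (fun i _ => add_nonneg dist_nonneg (C.cyl i).radius_pos.le) (Finset.mem_univ j)

/-- The planar region `F` has area at most `A`, and all the cylinders lie above `F`. -/
def CylinderChain.CoveredBy {P : Problem} {M : ℕ} (C : CylinderChain P M) (A : ℝ)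
    (F : Set Plane) : Prop :=
  volume F ≤ ENNReal.ofReal A ∧ ∀ i, (C.cyl i).carrier ⊆ F ×ˢ Set.univ

lemma CylinderChain.carrier_subset {P : Problem} {M : ℕ} (C : CylinderChain P M)
    {γ : ℝ → Pose} {L ε ρ : ℝ} (hL : 0 ≤ L) (hγ : HasUnitSpeedOn γ (Set.Icc 0 L))
    (hρm : 2 * C.maxDist γ L ≤ ρ) (hερ : 4 * ε ≤ ρ) {V : Set Pose}
    (hV : ∀ s ∈ Set.Icc 0 L, ∃ w ∈ insert P.pStart (insert P.pGoal V), dist (γ s) w ≤ 2 * ε)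
    (i : Fin M) : (C.cyl i).carrier ⊆ P.sampleRegion ρ V ×ˢ Set.univ := by
  intro x hx
  have hcomp : IsCompact ((fun s => xy (γ s)) '' Set.Icc 0 L) :=
    isCompact_Icc.image_of_continuousOn
      (lipschitzWith_xy.continuous.comp_continuousOn (continuousOn_of_hasUnitSpeedOn hγ))
  obtain ⟨_, ⟨s, hs, rfl⟩, hd⟩ :=
    hcomp.exists_infDist_eq_dist ⟨_, 0, ⟨le_rfl, hL⟩, rfl⟩ x.1
  have h1 := C.infDist_le_maxDist (γ := γ) hL hx
  obtain ⟨w, hw, hwd⟩ := hV s hs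
  refine ⟨Set.mem_biUnion hw ?_, trivial⟩
  rw [Metric.mem_closedBall]
  linarith [dist_triangle x.1 (xy (γ s)) (xy w), dist_xy_le (γ s) w]

lemma volume_sampleRegion_le {P : Problem} (ρ : ℝ) (l : List Pose) :
    volume (P.sampleRegion ρ {v | v ∈ l}) ≤
      (l.length + 2 : ℕ) * volume (Metric.closedBall (0 : Plane) ρ) := by
  classical
  have hset : insert P.pStart (insert P.pGoal {v | v ∈ l}) =
      ((P.pStart :: P.pGoal :: l).toFinset : Set Pose) := by
    ext v
    simp
  rw [Problem.sampleRegion, hset]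
  refine (measure_biUnion_finset_le _ _).trans ?_
  simp only [Measure.addHaar_closedBall_center volume (xy _) ρ, Finset.sum_const, nsmul_eq_mul]
  gcongr
  exact List.toFinset_card_le _

/-! ### Possibility exploration -/

namespace Problem

variable {P : Problem}

/-- Outside an exceptional set of pose samples, one of the routes found follows the given path,
visits as many samples as there are inner waypoints, and has a sampling region that covers all the
cylinders. -/
lemma exists_exceptional_poses {M : ℕ} (C : CylinderChain P M) {γ : ℝ → Pose} {L ε ρ A : ℝ}
    (hL : 0 ≤ L) (hε : 0 < ε) (hγ : HasUnitSpeedOn γ (Set.Icc 0 L)) (hγ0 : γ 0 = P.pStart)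
    (hγL : γ L = P.pGoal) (hεR : 2 * ε ≤ P.clearance γ L) (hρm : 2 * C.maxDist γ L ≤ ρ)
    (hερ : 4 * ε ≤ ρ)
    (hA : ∀ l : List Pose, l.length = ⌈L / ε⌉₊ - 1 → P.IsRoute l →
      volume (P.sampleRegion ρ {v | v ∈ l}) ≤ ENNReal.ofReal A) (N : ℕ) :
    ∃ B : Set (Fin N → Pose),
      P.poseLaw N B ≤ ENNReal.ofReal
        (L / ε * Real.exp (-(Real.pi ^ 3 * ε ^ 6 / (6 * P.volCN) * N))) ∧
      ∀ p ∉ B, ∃ T ∈ P.routes p,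
        C.CoveredBy A (P.sampleRegion ρ (p '' (T : Set (Fin N)))) := by
  classical
  set n := ⌈L / ε⌉₊ - 1 with hn
  set U : Fin n → Set Pose := fun j => Metric.ball (γ (wayTime L ε (j + 1))) ε with hU
  have hUCN : ∀ j, U j ⊆ P.CN := fun j =>
    (Metric.ball_subset_ball (by linarith)).trans (ball_clearance_subset (wayTime_mem hL hε _))
  have hvol : ∀ x : Pose, volume (Metric.ball x ε) = ENNReal.ofReal (Real.pi ^ 3 * ε ^ 6 / 6) := by
    intro x
    have hG : Real.Gamma (6 / 2 + 1) = 6 := by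
      rw [show (6 / 2 + 1 : ℝ) = (3 : ℕ) + 1 by norm_num, Real.Gamma_nat_eq_factorial]
      norm_num [Nat.factorial]
    have hs : √Real.pi ^ 6 = Real.pi ^ 3 := by
      rw [show 6 = 2 * 3 from rfl, pow_mul, Real.sq_sqrt Real.pi_pos.le]
    rw [EuclideanSpace.volume_ball, Fintype.card_fin, ← ENNReal.ofReal_pow hε.le,
      ← ENNReal.ofReal_mul (by positivity)]
    push_cast
    rw [hG, hs]
    ring_nf
  have hCN0 : volume P.CN ≠ 0 := by
    refine ne_of_gt (lt_of_lt_of_le ?_ (measure_mono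
      ((Metric.ball_subset_ball (ε₁ := ε) (by linarith)).trans
        (ball_clearance_subset (γ := γ) (s := 0) ⟨le_rfl, hL⟩))))
    exact Metric.measure_ball_pos volume _ hε
  have : IsProbabilityMeasure (ProbabilityTheory.cond volume P.CN) :=
    ProbabilityTheory.cond_isProbabilityMeasure_of_finite hCN0 volume_CN_lt_top.ne
  have hCNpos : 0 < P.volCN := ENNReal.toReal_pos hCN0 volume_CN_lt_top.ne
  have hlaw : ∀ j, ENNReal.ofReal (Real.pi ^ 3 * ε ^ 6 / (6 * P.volCN)) ≤
      ProbabilityTheory.cond volume P.CN (U j) := by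
    intro j
    rw [ProbabilityTheory.cond_apply P.measurableSet_CN,
      Set.inter_eq_self_of_subset_right (hUCN j), hvol,
      ← ENNReal.ofReal_toReal volume_CN_lt_top.ne, ← volCN, ← ENNReal.ofReal_inv_of_pos hCNpos,
      ← ENNReal.ofReal_mul (by positivity)]
    refine ENNReal.ofReal_le_ofReal (le_of_eq ?_)
    field_simp
  refine ⟨⋃ j, {p | ∀ k, p k ∉ U j}, ?_, ?_⟩
  · have hnL : (n : ℝ) ≤ L / ε := by
      have h0 : 0 ≤ L / ε := div_nonneg hL hε.le
      rcases Nat.eq_zero_or_pos ⌈L / ε⌉₊ with h | h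
      · simpa [hn, h] using h0
      · have := Nat.ceil_lt_add_one h0
        rw [hn, Nat.cast_sub h]
        push_cast
        linarith
    calc P.poseLaw N (⋃ j, {p | ∀ k, p k ∉ U j})
        ≤ ∑ j, P.poseLaw N {p | ∀ k, p k ∉ U j} := measure_iUnion_fintype_le _ _
      _ ≤ ∑ _j : Fin n, ENNReal.ofReal
          (Real.exp (-(Real.pi ^ 3 * ε ^ 6 / (6 * P.volCN) * N))) :=
        Finset.sum_le_sum fun j _ =>
          pi_forall_notMem_le _ Metric.isOpen_ball.measurableSet (hlaw j) N
      _ = ENNReal.ofReal (n * Real.exp (-(Real.pi ^ 3 * ε ^ 6 / (6 * P.volCN) * N))) := by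
        rw [Finset.sum_const, Finset.card_univ, Fintype.card_fin, nsmul_eq_mul,
          ENNReal.ofReal_mul (Nat.cast_nonneg _), ENNReal.ofReal_natCast]
      _ ≤ _ := by gcongr
  · intro p hp
    have hp' : ∀ j, ∃ k, p k ∈ U j := by simpa using hp
    choose k hk using hp'
    have hv : ∀ j, dist ((p ∘ k) j) (γ (wayTime L ε (j + 1))) < ε := hk
    have hmap : (List.ofFn k).map p = List.ofFn (p ∘ k) := by simp [List.map_ofFn]
    have hroute : P.IsRoute ((List.ofFn k).map p) := by
      rw [hmap]
      exact isRoute_ofFn hL hε hγ hγ0 hγL hεR _ hv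
    have himage : p '' ((List.ofFn k).toFinset : Set (Fin N)) =
        {v | v ∈ (List.ofFn k).map p} := by
      ext v
      simp
    have hrange : {v | v ∈ (List.ofFn k).map p} = Set.range (p ∘ k) := by
      ext v
      simp
    refine ⟨(List.ofFn k).toFinset,
      Finset.mem_filter.2 ⟨Finset.mem_univ _, _, by congr!, hroute⟩, ?_, ?_⟩
    · rw [himage]
      exact hA _ (by simp [hn]) hroute
    · rw [himage, hrange]
      exact C.carrier_subset hL hγ hρm hερ fun s hs =>
        exists_vertex_near hL hε hγ hγ0 hγL _ hv hs

/-- The failure probability of the whole pipeline is at most that of possibility exploration plus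
that of the later stages for a single suitable route, since the runs for other routes can only
help. Neither the integrand nor the exceptional set need be measurable. -/
lemma lintegral_prod_routes_le {N : ℕ} {B : Set (Fin N → Pose)}
    (f : Set Pose → ℝ≥0∞) (hf : ∀ V, f V ≤ 1) {a b : ℝ≥0∞} (ha : P.poseLaw N B ≤ a)
    (hb : ∀ p ∉ B, ∃ T ∈ P.routes p, f (p '' (T : Set (Fin N))) ≤ b) :
    ∫⁻ p, ∏ T ∈ P.routes p, f (p '' (T : Set (Fin N))) ∂(P.poseLaw N) ≤ a + b := by
  have hle1 : P.poseLaw N Set.univ ≤ 1 := by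
    unfold poseLaw
    rw [Measure.pi_univ]
    refine Finset.prod_le_one' fun _ _ => ?_
    rw [ProbabilityTheory.cond, Measure.smul_apply, smul_eq_mul, Measure.restrict_apply_univ]
    exact ENNReal.inv_mul_le_one _
  calc ∫⁻ p, ∏ T ∈ P.routes p, f (p '' (T : Set (Fin N))) ∂(P.poseLaw N)
      ≤ ∫⁻ p, (B.indicator (fun _ => 1) p + b) ∂(P.poseLaw N) := by
        refine lintegral_mono fun p => ?_
        by_cases hp : p ∈ B
        · rw [Set.indicator_of_mem hp]
          exact (Finset.prod_le_one' fun T _ => hf _).trans le_self_add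
        · obtain ⟨T, hT, hfT⟩ := hb p hp
          rw [Set.indicator_of_notMem hp, zero_add, ← Finset.mul_prod_erase _ _ hT]
          exact (mul_le_of_le_one_right' (Finset.prod_le_one' fun T _ => hf _)).trans hfT
    _ ≤ P.poseLaw N B + b * P.poseLaw N Set.univ := by
        rw [lintegral_add_right _ measurable_const, lintegral_const]
        gcongr
        simpa using lintegral_indicator_const_le B (1 : ℝ≥0∞)
    _ ≤ a + b := add_le_add ha (mul_le_of_le_one_right' hle1)

end Problem

/-! ### Sampling placements in the cylinders -/

lemma Cylinder.isCompact_carrier (c : Cylinder) : IsCompact c.carrier :=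
  (isCompact_closedBall _ _).prod Metric.isClosed_closedBall.isCompact

lemma Cylinder.volume_carrier (c : Cylinder) :
    volume c.carrier = ENNReal.ofReal (c.radius ^ 2 * Real.pi * c.height) := by
  rw [Cylinder.carrier, Measure.volume_eq_prod, Measure.prod_prod,
    EuclideanSpace.volume_closedBall_fin_two, AddCircle.volume_closedBall,
    mul_div_cancel₀ _ two_ne_zero, min_eq_right c.height_le,
    ← ENNReal.ofReal_pow c.radius_pos.le, ← ENNReal.ofReal_mul (by positivity),
    ← ENNReal.ofReal_mul (by positivity)]

lemma Cylinder.volume_carrier_pos (c : Cylinder) : 0 < volume c.carrier := by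
  have := c.radius_pos
  have := c.height_pos
  rw [c.volume_carrier, ENNReal.ofReal_pos]
  positivity

lemma volume_prod_circle_le {F : Set Plane} {A : ℝ} (hA : 0 < A)
    (hF : volume F ≤ ENNReal.ofReal A) :
    volume (F ×ˢ (Set.univ : Set (AddCircle (2 * Real.pi)))) ≤
      ENNReal.ofReal (A * (2 * Real.pi)) := by
  rw [Measure.volume_eq_prod, Measure.prod_prod, AddCircle.measure_univ, ENNReal.ofReal_mul hA.le]
  gcongr

/-- Uniform sampling above a region `F` of area at most `A` dominates a fixed measure on any set
of placements above `F`. -/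
lemma smul_restrict_le_cond {F : Set Plane} {A : ℝ} (hA : 0 < A)
    (hF : volume F ≤ ENNReal.ofReal A) {Z : Set Placement} (hZ : Z ⊆ F ×ˢ Set.univ) :
    (ENNReal.ofReal (A * (2 * Real.pi)))⁻¹ • volume.restrict Z ≤
      ProbabilityTheory.cond volume (F ×ˢ Set.univ) := by
  refine Measure.le_iff.2 fun s _ => ?_
  rw [ProbabilityTheory.cond, Measure.smul_apply, Measure.smul_apply, smul_eq_mul, smul_eq_mul]
  gcongr
  exact volume_prod_circle_le hA hF

lemma le_cond_carrier {F : Set Plane} {A : ℝ} (hA : 0 < A) (hF : volume F ≤ ENNReal.ofReal A)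
    (c : Cylinder) (hc : c.carrier ⊆ F ×ˢ Set.univ) :
    ENNReal.ofReal (c.radius ^ 2 * c.height / (2 * A)) ≤
      ProbabilityTheory.cond volume (F ×ˢ Set.univ) c.carrier := by
  refine le_trans (le_of_eq ?_) (smul_restrict_le_cond hA hF hc c.carrier)
  have := Real.pi_pos
  rw [Measure.smul_apply, smul_eq_mul, Measure.restrict_apply_self, c.volume_carrier,
    ← ENNReal.ofReal_inv_of_pos (by positivity), ← ENNReal.ofReal_mul (by positivity)]
  congr 1
  field_simp

namespace Problem

variable {P : Problem}

lemma volume_sampleRegion_pos {ρ : ℝ} (hρ : 0 < ρ) (V : Set Pose) :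
    0 < volume (P.sampleRegion ρ V) :=
  (Metric.measure_closedBall_pos volume (xy P.pStart) hρ).trans_le
    (measure_mono (Set.subset_biUnion_of_mem (u := fun v => Metric.closedBall (xy v) ρ)
      (Set.mem_insert _ _)))

lemma isProbabilityMeasure_cond_sampleRegion {ρ A : ℝ} (hρ : 0 < ρ) {V : Set Pose}
    (hF : volume (P.sampleRegion ρ V) ≤ ENNReal.ofReal A) :
    IsProbabilityMeasure (ProbabilityTheory.cond volume
      (P.sampleRegion ρ V ×ˢ (Set.univ : Set (AddCircle (2 * Real.pi))))) := by
  have hA : 0 < A := ENNReal.ofReal_pos.1 ((volume_sampleRegion_pos hρ V).trans_le hF)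
  refine ProbabilityTheory.cond_isProbabilityMeasure_of_finite ?_
    ((volume_prod_circle_le hA hF).trans_lt ENNReal.ofReal_lt_top).ne
  rw [Measure.volume_eq_prod, Measure.prod_prod, AddCircle.measure_univ]
  exact mul_ne_zero (volume_sampleRegion_pos hρ V).ne'
    (ENNReal.ofReal_pos.2 Real.two_pi_pos).ne'

lemma placementLaw_univ_le_one (ρ : ℝ) (V : Set Pose) (N : ℕ) :
    P.placementLaw ρ V N Set.univ ≤ 1 := by
  have h : (Measure.pi fun _ : Fin N => ProbabilityTheory.cond volume
      (P.sampleRegion ρ V ×ˢ (Set.univ : Set (AddCircle (2 * Real.pi))))) Set.univ ≤ 1 := by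
    rw [Measure.pi_univ]
    refine Finset.prod_le_one' fun _ _ => ?_
    rw [ProbabilityTheory.cond, Measure.smul_apply, smul_eq_mul, Measure.restrict_apply_univ]
    exact ENNReal.inv_mul_le_one _
  rw [placementLaw, ← Set.univ_prod_univ, Measure.prod_prod]
  exact mul_le_one' h h

/-- Mode sampling for a route whose sampling region covers all the cylinders fails only if some
cylinder is missed by all the samples of its foot. -/
lemma placementLaw_not_connects_le {M : ℕ} (C : CylinderChain P M) {ρ A c : ℝ} (hρ : 0 < ρ)
    (hc : ∀ i, c ≤ (C.cyl i).radius ^ 2 * (C.cyl i).height / (2 * A)) {V : Set Pose}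
    (hV : C.CoveredBy A (P.sampleRegion ρ V)) (N : ℕ) :
    P.placementLaw ρ V N {s | ¬ P.Connects (P.sampledModes s) P.start P.goal} ≤
      ENNReal.ofReal (M * Real.exp (-(c * N))) := by
  have := isProbabilityMeasure_cond_sampleRegion hρ hV.1
  have hA : 0 < A := ENNReal.ofReal_pos.1 ((volume_sampleRegion_pos hρ V).trans_le hV.1)
  have hone : ∀ i (f : Foot),
      P.placementLaw ρ V N {s | ∀ k, f.pick (s.1 k) (s.2 k) ∉ (C.cyl i).carrier} ≤
        ENNReal.ofReal (Real.exp (-(c * N))) := by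
    intro i f
    have hmiss := pi_forall_notMem_le _ (C.cyl i).isCompact_carrier.measurableSet
      ((ENNReal.ofReal_le_ofReal (hc i)).trans (le_cond_carrier hA hV.1 _ (hV.2 i))) N
    cases f with
    | left =>
      have hset : {s : (Fin N → Placement) × (Fin N → Placement) |
          ∀ k, Foot.left.pick (s.1 k) (s.2 k) ∉ (C.cyl i).carrier} =
          {l | ∀ k, l k ∉ (C.cyl i).carrier} ×ˢ Set.univ := by
        ext s
        simp [Foot.pick]
      rw [hset, placementLaw, Measure.prod_prod, measure_univ, mul_one]
      exact hmiss
    | right =>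
      have hset : {s : (Fin N → Placement) × (Fin N → Placement) |
          ∀ k, Foot.right.pick (s.1 k) (s.2 k) ∉ (C.cyl i).carrier} =
          Set.univ ×ˢ {l | ∀ k, l k ∉ (C.cyl i).carrier} := by
        ext s
        simp [Foot.pick]
      rw [hset, placementLaw, Measure.prod_prod, measure_univ, one_mul]
      exact hmiss
  have hsub : {s : (Fin N → Placement) × (Fin N → Placement) |
      ¬ P.Connects (P.sampledModes s) P.start P.goal} ⊆
      ⋃ i : Fin M, {s | ∀ k, (C.foot i.succ.castSucc).pick (s.1 k) (s.2 k) ∉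
        (C.cyl i).carrier} := by
    intro s hs
    by_contra hcon
    exact hs (C.connects s (by simpa using hcon))
  refine (measure_mono hsub).trans ((measure_iUnion_fintype_le _ _).trans
    ((Finset.sum_le_sum fun i _ => hone i _).trans (le_of_eq ?_)))
  rw [Finset.sum_const, Finset.card_univ, Fintype.card_fin, nsmul_eq_mul,
    ENNReal.ofReal_mul (Nat.cast_nonneg _), ENNReal.ofReal_natCast]

/-! ### Uniformity of the roadmap planner over the sampled placements -/

/-- The last two stages fail with exponentially small probability, uniformly over all routes whose
sampling region covers the cylinders and has area at most `A`. The rate at which the roadmap planner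
succeeds depends on the placements. It is uniform on a set of tuples of placements of positive
measure, because the tuples from the cylinders are the union of countably many measurable sets
with a uniform rate each. With many samples, some block of them hits that set. -/
lemma exists_lintegral_prmFailure_le {M : ℕ} (C : CylinderChain P M) {ρ A : ℝ} (hρ : 0 < ρ)
    (hA : 0 < A)
    (hmeas : ∀ Nσ NM : ℕ, Measurable fun s : (Fin Nσ → Placement) × (Fin Nσ → Placement) =>
      P.prmFailure (P.sampledModes s) NM) :
    ∃ δ : ℝ, 0 < δ ∧ ∃ K : ℕ, ∀ V, C.CoveredBy A (P.sampleRegion ρ V) → ∀ Nσ NM : ℕ,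
      ∫⁻ s, P.prmFailure (P.sampledModes s) NM ∂(P.placementLaw ρ V Nσ) ≤
        ENNReal.ofReal (Real.exp (-(δ * (Nσ / (M + 1) : ℕ)))) +
          ENNReal.ofReal (K * Real.exp (-(1 / ((K : ℝ) + 1) * NM))) := by
  set Z : Set Placement := ⋃ i, (C.cyl i).carrier with hZ
  have hZc : IsCompact Z := isCompact_iUnion fun i => (C.cyl i).isCompact_carrier
  set a : ℝ≥0∞ := (ENNReal.ofReal (A * (2 * Real.pi)))⁻¹ with ha
  have ha0 : a ≠ 0 := ENNReal.inv_ne_zero.2 ENNReal.ofReal_ne_top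
  have hatop : a ≠ ∞ := ENNReal.inv_ne_top.2
    (ENNReal.ofReal_pos.2 (mul_pos hA Real.two_pi_pos)).ne'
  -- `κ₀` lies below the law of a placement for every route in question, so a lower bound for
  -- the product of copies of `κ₀` is uniform over the routes
  set κ₀ : Measure Placement := a • volume.restrict Z with hκ₀
  have hfin : IsFiniteMeasure κ₀ := by
    refine ⟨?_⟩
    rw [hκ₀, Measure.smul_apply, smul_eq_mul, Measure.restrict_apply_univ]
    exact ENNReal.mul_lt_top hatop.lt_top hZc.measure_lt_top
  set κ : Measure (Fin M → Placement × Placement) := Measure.pi fun _ => κ₀.prod κ₀ with hκ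
  set E : ℕ → Set (Fin M → Placement × Placement) := fun K => {t | ∀ N : ℕ,
    P.prmFailure (P.sampledModes (fun j => (t j).1, fun j => (t j).2)) N ≤
      ENNReal.ofReal (K * Real.exp (-(1 / ((K : ℝ) + 1) * N)))} with hE
  have hEm : ∀ K, MeasurableSet (E K) := by
    intro K
    simp only [hE, Set.ofPred_forall]
    exact MeasurableSet.iInter fun N =>
      measurableSet_le ((hmeas M N).comp (by fun_prop)) measurable_const
  have hpos : κ (⋃ K, E K) ≠ 0 := by
    have hsub : (Set.univ.pi fun i => (C.cyl i).carrier ×ˢ (C.cyl i).carrier) ⊆ ⋃ K, E K := by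
      intro t ht
      have hconn := C.connects (fun j => (t j).1, fun j => (t j).2) fun i =>
        ⟨i, by
          have := ht i trivial
          cases C.foot i.succ.castSucc
          · exact this.1
          · exact this.2⟩
      obtain ⟨K, hK⟩ := exists_prmFailure_le hconn
      exact Set.mem_iUnion.2 ⟨K, hK⟩
    refine ne_of_gt (lt_of_lt_of_le (pos_iff_ne_zero.2 ?_) (measure_mono hsub))
    rw [hκ, Measure.pi_pi]
    refine Finset.prod_ne_zero_iff.2 fun i _ => ?_
    have hi : κ₀ (C.cyl i).carrier ≠ 0 := by
      rw [hκ₀, Measure.smul_apply, smul_eq_mul,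
        Measure.restrict_eq_self _ (Set.subset_iUnion (fun i => (C.cyl i).carrier) i)]
      exact mul_ne_zero ha0 (C.cyl i).volume_carrier_pos.ne'
    rw [Measure.prod_prod]
    exact mul_ne_zero hi hi
  obtain ⟨K, hK⟩ := exists_measure_pos_of_not_measure_iUnion_null hpos
  refine ⟨(κ (E K)).toReal, ENNReal.toReal_pos hK.ne' (measure_ne_top _ _), K, ?_⟩
  intro V hV Nσ NM
  have := isProbabilityMeasure_cond_sampleRegion hρ hV.1
  set μ : Measure Placement := ProbabilityTheory.cond volume (P.sampleRegion ρ V ×ˢ Set.univ)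
    with hμ
  have hle : κ₀ ≤ μ := smul_restrict_le_cond hA hV.1 (Set.iUnion_subset hV.2)
  have hδ : ENNReal.ofReal (κ (E K)).toReal ≤ Measure.pi (fun _ : Fin M => μ.prod μ) (E K) := by
    rw [ENNReal.ofReal_toReal (measure_ne_top _ _)]
    exact measure_pi_mono (fun _ => Measure.prod_mono hle hle) _
  have hq : Nσ / (M + 1) * M ≤ Nσ :=
    (Nat.mul_le_mul_left _ (Nat.le_succ M)).trans (Nat.div_mul_le_self _ _)
  -- dividing by `M + 1` rather than by `M` covers the case `M = 0`, where blocks are empty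
  let e : Fin (Nσ / (M + 1)) × Fin M ↪ Fin Nσ :=
    finProdFinEquiv.toEmbedding.trans (Fin.castLEEmb hq)
  have hblocks := pi_forall_blocks_notMem_le (μ.prod μ) e (hEm K) hδ
  set B : Set (Fin Nσ → Placement × Placement) := {t | ∀ b, (fun j => t (e (b, j))) ∉ E K}
  have hpres := measurePreserving_arrowProdEquivProdArrow Placement Placement (Fin Nσ)
    (fun _ => μ) (fun _ => μ)
  have hlaw : P.placementLaw ρ V Nσ =
      (Measure.pi fun _ : Fin Nσ => μ).prod (Measure.pi fun _ : Fin Nσ => μ) := rfl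
  rw [hlaw, ← hpres.lintegral_comp_emb (MeasurableEquiv.measurableEmbedding _)]
  set b := ENNReal.ofReal (K * Real.exp (-(1 / ((K : ℝ) + 1) * NM))) with hb
  calc _ ≤ ∫⁻ t, (B.indicator (fun _ => 1) t + b) ∂(Measure.pi fun _ : Fin Nσ => μ.prod μ) := by
        refine lintegral_mono fun t => ?_
        by_cases ht : t ∈ B
        · rw [Set.indicator_of_mem ht]
          exact (prmFailure_le_one _ _).trans le_self_add
        · rw [Set.indicator_of_notMem ht, zero_add]
          obtain ⟨i, hi⟩ : ∃ i, (fun j => t (e (i, j))) ∈ E K := by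
            by_contra! h
            exact ht h
          exact (prmFailure_anti (sampledModes_comp_subset
            (fun k => (t k).1, fun k => (t k).2) fun j => e (i, j)) NM).trans (hi NM)
    _ ≤ Measure.pi (fun _ : Fin Nσ => μ.prod μ) B + b := by
        rw [lintegral_add_right _ measurable_const, lintegral_const, measure_univ, mul_one]
        gcongr
        simpa using lintegral_indicator_const_le B (1 : ℝ≥0∞)
    _ ≤ _ := by gcongr

end Problem

end WRPG

end

/-! ### The failure probabilities of the pipeline -/

theorem mainTheorem1 (P : WRPG.Problem) (M : ℕ) (C : WRPG.CylinderChain P M)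
    -- a path in the exploration space, parametrized by arclength, with positive clearance
    (L : ℝ) (hL : 0 ≤ L) (γ : ℝ → WRPG.Pose) (hγ : HasUnitSpeedOn γ (Set.Icc 0 L))
    (hγ0 : γ 0 = P.pStart) (hγL : γ L = P.pGoal) (hR : 0 < P.clearance γ L)
    (ρ : ℝ) (hρ : 0 < ρ) (hρm : 2 * C.maxDist γ L ≤ ρ)
    (ε : ℝ) (hε : ε = min (P.clearance γ L / 2) (ρ / 4))
    -- the success probability of the last stage depends measurably on the sampled placements
    (hmeas : ∀ Nσ NM : ℕ,
      Measurable fun s : (Fin Nσ → WRPG.Placement) × (Fin Nσ → WRPG.Placement) =>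
        P.prmFailure (P.sampledModes s) NM) :
    -- the first two stages; `m` is a cylinder of least volume, `A` bounds the area of the
    -- sampling region of each route with `⌈L / ε⌉ - 1` intermediate vertices
    (∀ m : Fin M, (∀ i, (C.cyl m).radius ^ 2 * (C.cyl m).height ≤
        (C.cyl i).radius ^ 2 * (C.cyl i).height) →
      ∀ A : ℝ, (∀ l : List WRPG.Pose, l.length = ⌈L / ε⌉₊ - 1 → P.IsRoute l →
          MeasureTheory.volume (P.sampleRegion ρ {v | v ∈ l}) ≤ ENNReal.ofReal A) →
      ∀ NP Nσ : ℕ, P.twoStageFailure ρ NP Nσ ≤ ENNReal.ofReal ((L / ε + M) *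
        Real.exp (-min (Real.pi ^ 3 * ε ^ 6 / (6 * P.volCN) * NP)
          ((C.cyl m).radius ^ 2 * (C.cyl m).height / (2 * A) * Nσ)))) ∧
    -- all three stages
    (∃ α β : ℝ, 0 < α ∧ 0 < β ∧ ∀ NP Nσ NM : ℕ, P.overallFailure ρ NP Nσ NM ≤
      ENNReal.ofReal (α * Real.exp (-(β * (min NP (min Nσ NM) : ℕ))))) ∧
    Filter.Tendsto (fun N : ℕ × ℕ × ℕ => P.overallFailure ρ N.1 N.2.1 N.2.2)
      Filter.atTop (nhds 0) := by
  have hε0 : 0 < ε := by rw [hε]; exact lt_min (by linarith) (by linarith)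
  have hεR : 2 * ε ≤ P.clearance γ L := by
    linarith [hε.le.trans (min_le_left (P.clearance γ L / 2) (ρ / 4))]
  have hερ : 4 * ε ≤ ρ := by
    linarith [hε.le.trans (min_le_right (P.clearance γ L / 2) (ρ / 4))]
  have hLε : 0 ≤ L / ε := div_nonneg hL hε0.le
  have hoverall : ∃ α β : ℝ, 0 < α ∧ 0 < β ∧ ∀ NP Nσ NM : ℕ, P.overallFailure ρ NP Nσ NM ≤
      ENNReal.ofReal (α * Real.exp (-(β * (min NP (min Nσ NM) : ℕ)))) := by
    -- a route with `n` intermediate vertices is covered by `n + 2` discs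
    set A : ℝ := (⌈L / ε⌉₊ - 1 + 2 : ℕ) * (ρ ^ 2 * Real.pi) with hAdef
    have hA : 0 < A := by
      have := Real.pi_pos
      have : (0 : ℝ) < (⌈L / ε⌉₊ - 1 + 2 : ℕ) := by exact_mod_cast (by omega)
      positivity
    have hroutes : ∀ l : List WRPG.Pose, l.length = ⌈L / ε⌉₊ - 1 → P.IsRoute l →
        MeasureTheory.volume (P.sampleRegion ρ {v | v ∈ l}) ≤ ENNReal.ofReal A := by
      intro l hl _
      refine (WRPG.volume_sampleRegion_le ρ l).trans (le_of_eq ?_)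
      rw [hl, EuclideanSpace.volume_closedBall_fin_two, hAdef,
        ENNReal.ofReal_mul (Nat.cast_nonneg _), ENNReal.ofReal_natCast,
        ENNReal.ofReal_mul (by positivity), ENNReal.ofReal_pow hρ.le]
    obtain ⟨δ, hδ, K, hK⟩ := WRPG.Problem.exists_lintegral_prmFailure_le C hρ hA hmeas
    set c := Real.pi ^ 3 * ε ^ 6 / (6 * P.volCN) with hc
    have hc0 : 0 < c := by
      have hv : 0 < P.volCN := by
        refine ENNReal.toReal_pos (ne_of_gt ?_) WRPG.Problem.volume_CN_lt_top.ne
        exact (Metric.measure_ball_pos MeasureTheory.volume (γ 0) hR).trans_le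
          (MeasureTheory.measure_mono (WRPG.Problem.ball_clearance_subset ⟨le_rfl, hL⟩))
      have := Real.pi_pos
      positivity
    have hβ : 0 < min c (min (δ / (M + 1)) (1 / ((K : ℝ) + 1))) :=
      lt_min hc0 (lt_min (by positivity) (by positivity))
    refine ⟨L / ε + Real.exp δ + K, min c (min (δ / (M + 1)) (1 / ((K : ℝ) + 1))),
      by positivity, hβ, fun NP Nσ NM => ?_⟩
    obtain ⟨B, hB, hgood⟩ := WRPG.Problem.exists_exceptional_poses C hL hε0 hγ hγ0 hγL hεR hρm hερ
      hroutes NP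
    have hmain := WRPG.Problem.lintegral_prod_routes_le (P := P)
      (fun V => ∫⁻ s, P.prmFailure (P.sampledModes s) NM ∂(P.placementLaw ρ V Nσ))
      (fun V => ?_) hB (b := ENNReal.ofReal (Real.exp (-(δ * (Nσ / (M + 1) : ℕ)))) +
        ENNReal.ofReal (K * Real.exp (-(1 / ((K : ℝ) + 1) * NM)))) fun p hp => ?_
    -- the factor `exp δ` makes up for the samples outside the complete blocks
    · refine hmain.trans ?_
      rw [← ENNReal.ofReal_add (by positivity) (by positivity),
        ← ENNReal.ofReal_add (by positivity) (by positivity)]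
      refine ENNReal.ofReal_le_ofReal ?_
      set β := min c (min (δ / (M + 1)) (1 / ((K : ℝ) + 1)))
      have hn1 : ((min NP (min Nσ NM) : ℕ) : ℝ) ≤ NP := by exact_mod_cast min_le_left _ _
      have hn2 : ((min NP (min Nσ NM) : ℕ) : ℝ) ≤ Nσ := by
        exact_mod_cast (min_le_right _ _).trans (min_le_left _ _)
      have hn3 : ((min NP (min Nσ NM) : ℕ) : ℝ) ≤ NM := by
        exact_mod_cast (min_le_right _ _).trans (min_le_right _ _)
      set n : ℝ := ((min NP (min Nσ NM) : ℕ) : ℝ)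
      have hn0 : 0 ≤ n := Nat.cast_nonneg _
      have e1 : Real.exp (-(c * NP)) ≤ Real.exp (-(β * n)) := by
        refine Real.exp_le_exp.2 (neg_le_neg ?_)
        exact mul_le_mul (min_le_left _ _) hn1 hn0 hc0.le
      have e3 : Real.exp (-(1 / ((K : ℝ) + 1) * NM)) ≤ Real.exp (-(β * n)) := by
        refine Real.exp_le_exp.2 (neg_le_neg ?_)
        exact mul_le_mul ((min_le_right _ _).trans (min_le_right _ _)) hn3 hn0 (by positivity)
      have e2 : Real.exp (-(δ * (Nσ / (M + 1) : ℕ))) ≤ Real.exp δ * Real.exp (-(β * n)) := by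
        rw [← Real.exp_add]
        refine Real.exp_le_exp.2 ?_
        have h1 : β * n ≤ δ / (M + 1) * Nσ :=
          mul_le_mul ((min_le_right _ _).trans (min_le_left _ _)) hn2 hn0 (by positivity)
        have h2 : (Nσ : ℝ) / (M + 1) ≤ (Nσ / (M + 1) : ℕ) + 1 := by
          rw [div_le_iff₀ (by positivity)]
          exact_mod_cast (Nat.lt_div_mul_add (a := Nσ) (Nat.succ_pos M)).le.trans
            (by rw [add_mul, one_mul])
        have h3 := mul_le_mul_of_nonneg_left h2 hδ.le
        have h4 : δ / (M + 1) * Nσ = δ * (Nσ / (M + 1)) := by ring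
        linarith
      calc _ ≤ L / ε * Real.exp (-(β * n)) + (Real.exp δ * Real.exp (-(β * n)) +
            K * Real.exp (-(β * n))) := by gcongr
        _ = _ := by ring
    · calc _ ≤ ∫⁻ _, 1 ∂(P.placementLaw ρ V Nσ) :=
            MeasureTheory.lintegral_mono fun s => WRPG.Problem.prmFailure_le_one _ _
        _ ≤ 1 := by
            rw [MeasureTheory.lintegral_one]
            exact WRPG.Problem.placementLaw_univ_le_one ρ V Nσ
    · obtain ⟨T, hT, hcov⟩ := hgood p hp
      exact ⟨T, hT, hK _ hcov Nσ NM⟩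
  refine ⟨?_, hoverall, ?_⟩
  · intro m hm A hA NP Nσ
    obtain ⟨B, hB, hgood⟩ := WRPG.Problem.exists_exceptional_poses C hL hε0 hγ hγ0 hγL hεR hρm hερ
      hA NP
    refine (WRPG.Problem.lintegral_prod_routes_le (P := P)
      (fun V => P.placementLaw ρ V Nσ {s | ¬ P.Connects (P.sampledModes s) P.start P.goal})
      (fun V => (MeasureTheory.measure_mono (Set.subset_univ _)).trans
        (WRPG.Problem.placementLaw_univ_le_one ρ V Nσ)) hB
      (b := ENNReal.ofReal (M * Real.exp
        (-((C.cyl m).radius ^ 2 * (C.cyl m).height / (2 * A) * Nσ)))) fun p hp => ?_).trans ?_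
    -- a route of the given length exists, hence `A` is positive
    · obtain ⟨T, hT, hcov⟩ := hgood p hp
      have hA0 : 0 < A := ENNReal.ofReal_pos.1
        ((WRPG.Problem.volume_sampleRegion_pos hρ _).trans_le hcov.1)
      refine ⟨T, hT, WRPG.Problem.placementLaw_not_connects_le C hρ (fun i => ?_) hcov Nσ⟩
      exact div_le_div_of_nonneg_right (hm i) (by positivity)
    · rw [← ENNReal.ofReal_add (by positivity) (by positivity), add_mul]
      gcongr
      · exact min_le_left _ _
      · exact min_le_right _ _
  · obtain ⟨α, β, -, hβ, hle⟩ := hoverall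
    have hmin : Filter.Tendsto (fun N : ℕ × ℕ × ℕ => min N.1 (min N.2.1 N.2.2))
        Filter.atTop Filter.atTop := by
      refine Filter.tendsto_atTop.2 fun b => ?_
      filter_upwards [Filter.eventually_ge_atTop (b, b, b)] with N hN
      exact le_min hN.1 (le_min hN.2.1 hN.2.2)
    have hexp : Filter.Tendsto (fun n : ℕ => ENNReal.ofReal (α * Real.exp (-(β * n))))
        Filter.atTop (nhds 0) := by
      have h1 : Filter.Tendsto (fun n : ℕ => β * (n : ℝ)) Filter.atTop Filter.atTop :=
        tendsto_natCast_atTop_atTop.const_mul_atTop hβ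
      simpa using ENNReal.tendsto_ofReal ((Real.tendsto_exp_neg_atTop_nhds_zero.comp h1).const_mul α)
    exact tendsto_of_tendsto_of_tendsto_of_le_of_le tendsto_const_nhds (hexp.comp hmin)
      (fun _ => zero_le) fun N => hle N.1 N.2.1 N.2.2
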